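/- Let $0<\alpha<2$ and let $g:\mathbb R\to\mathbb R$ be a nonnegative Schwartz function (smooth, decaying with all its derivatives faster than every power of $1/|\xi|$) with $g(0)=1$. For $\gamma,l>0$ let $$P_L(x)=\frac1{2\pi}\int_{-\infty}^{\infty}e^{-iqx}\,e^{-\gamma^\alpha|q|^\alpha}\,dq$$ be the symmetric $\alpha$-stable density of scale $\gamma$, and let $P(x)=C\,P_L(x)\,g(x/l)$, with $C=\big(\int P_L(x)g(x/l)\,dx\big)^{-1}$, be the truncated Lévy density. Write $m_j=\int x^jP(x)\,dx$ for its moments, $\theta(q)=\int e^{iqx}P(x)\,dx$ for its characteristic function, $\kappa_j=(-i)^j\frac{d^j}{dq^j}\log\theta(q)\big|_{q=0}$ for its cumulants, $\lambda_j=\kappa_j/\kappa_2^{j/2}$ for its standardized cumulants, and $$\varepsilon=(\gamma/l)^\alpha,\qquad A(\alpha)=\tfrac2\pi\,\Gamma(\alpha+1)\sin\tfrac{\pi\alpha}2,\qquad \mu_j(\alpha)=\int_0^\infty \xi^{j-1-\alpha}g_j(\xi)\,d\xi,$$ where $g_j(\xi)=\frac12(g(\xi)+g(-\xi))$ for even $j$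 and $g_j(\xi)=\frac12(g(\xi)-g(-\xi))$ for odd $j$. Then: 1. For every $j\ge1$ the integral $\mu_j(\alpha)$, the Mellin transform of $g_j$ at $j-\alpha$, converges absolutely, and $\mu_j(\alpha)>0$ if $j$ is even. 2. Let $\gamma,l>0$ vary in any way such that $\varepsilon\to0$. Eventually $\int P=1$, all moments of $P$ exist, $\log\theta$ is smooth at $0$, and all the $\kappa_j$ are real. For every $j\ge1$, $$m_j=l^{\,j-\alpha}\gamma^\alpha A(\alpha)\mu_j(\alpha)+o(l^j\varepsilon),\qquad \kappa_j=l^{\,j-\alpha}\gamma^\alpha A(\alpha)\mu_j(\alpha)+o(l^j\varepsilon),$$ so that $\kappa_j$ and $m_j$ agree to first order in $\varepsilon$. 3. In the same limit, for every $j\ge3$, $$\lambda_j=\Big(\frac l\gamma\Big)^{\alpha(j-2)/2}\frac{\mu_j(\alpha)}{A(\alpha)^{j/2-1}\,\mu_2(\alpha)^{j/2}}+o\big(\varepsilon^{1-j/2}\big);$$ in particular $\lambda_j$ is of exact order $\varepsilon^{1-j/2}$ whenever $\mu_j(\alpha)\ne0$. 4. Odd cumulants are nonzero only under asymmetric truncation: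 if $g(-x)=g(x)$ for all $x$, then for every odd $j$ one has $\mu_j(\alpha)=0$, and $\kappa_j=0$ for all $\gamma,l>0$. -/

import Mathlib

open Filter Asymptotics
open scoped Topology ContDiff

noncomputable section

namespace TruncatedLevy

/-- Density at `x` of the symmetric `α`-stable Lévy law of scale `γ`, i.e. the Fourier inversion
`(2π)⁻¹ ∫ e^{-iqx} θ_L(q) dq` of its characteristic function `θ_L(q) = exp (-γ^α |q|^α)`.
As `θ_L` is real and even, only the cosine part of `e^{-iqx}` contributes. -/
def levyDensity (α γ x : ℝ) : ℝ :=
  (1 / (2 * Real.pi)) * ∫ q : ℝ, Real.exp (-(γ ^ α * |q| ^ α)) * Real.cos (q * x)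

/-- The normalizing constant `C` of the truncated Lévy distribution; the deformation function
of scale `l` is `x ↦ g (x / l)`. -/
def normConst (α γ l : ℝ) (g : ℝ → ℝ) : ℝ :=
  (∫ x : ℝ, levyDensity α γ x * g (x / l))⁻¹

/-- The truncated Lévy density `P(x) = C P_L(x) g(x / l)`. -/
def truncDensity (α γ l : ℝ) (g : ℝ → ℝ) (x : ℝ) : ℝ :=
  normConst α γ l g * levyDensity α γ x * g (x / l)

/-- The `j`-th moment of a density. -/
def moment (P : ℝ → ℝ) (j : ℕ) : ℝ := ∫ x : ℝ, x ^ j * P x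

/-- The characteristic function `θ(q) = ∫ e^{iqx} P(x) dx` of a density. -/
def charFn (P : ℝ → ℝ) (q : ℝ) : ℂ :=
  ∫ x : ℝ, Complex.exp (Complex.I * q * x) * (P x : ℂ)

/-- `(-i)^j` times the `j`-th derivative at the origin of the logarithm of the characteristic
function, as a complex number. -/
def complexCumulant (P : ℝ → ℝ) (j : ℕ) : ℂ :=
  (-Complex.I) ^ j * iteratedDeriv j (fun q : ℝ => Complex.log (charFn P q)) 0

/-- The `j`-th cumulant `κ_j` of a density, as a real number. -/
def cumulant (P : ℝ → ℝ) (j : ℕ) : ℝ := (complexCumulant P j).re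

/-- The standardized cumulant (cumulant coefficient) `λ_j = κ_j / σ^j`, where `σ² = κ_2`. -/
def stdCumulant (P : ℝ → ℝ) (j : ℕ) : ℝ :=
  cumulant P j / Real.sqrt (cumulant P 2) ^ j

/-- The even part of `g` for even `j`, the odd part of `g` for odd `j`. -/
def parityPart (g : ℝ → ℝ) (j : ℕ) (ξ : ℝ) : ℝ :=
  if Even j then (g ξ + g (-ξ)) / 2 else (g ξ - g (-ξ)) / 2

/-- `μ_j(α) = ∫_0^∞ ξ^(j-1-α) g_{even/odd}(ξ) dξ`. -/
def truncMellin (α : ℝ) (g : ℝ → ℝ) (j : ℕ) : ℝ :=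
  ∫ ξ in Set.Ioi (0 : ℝ), ξ ^ ((j : ℝ) - 1 - α) * parityPart g j ξ

/-- `A(α) = (2/π) Γ(α+1) sin(πα/2)`. -/
def levyAmplitude (α : ℝ) : ℝ :=
  (2 / Real.pi) * Real.Gamma (α + 1) * Real.sin (Real.pi * α / 2)

end TruncatedLevy

end

/-!
The density of the truncated law is determined, up to scaling, by the single ratio `r = γ / l`, and
everything rests on the power-law tail of the stable density `p = levyDensity α 1`:
`x ^ (1 + α) * p x → levyAmplitude α / 2` (`tendsto_levyDensity_tail`), together with the uniform
bound `|p x| ≤ K * x ^ (-1 - α)` on `(0, ∞)` (`abs_levyDensity_le_rpow`).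

Both come from one contour rotation. In the variable `q = exp ζ` the integral
`∫ exp (-q^α + iqx) dq` over the half-line becomes the integral of an entire function over a
horizontal line, and rotating the ray becomes moving that line (`integral_horizontal_eq`). On the
ray `arg z = π / 4` one has `Re z^α > 0`, because `α < 2`, and `e^{ixz}` decays, so the term
`∫ e^{ixz} dz = i / x` may be subtracted; it is purely imaginary and does not affect `p`. What
remains is an integral of `(exp (-z^α) - 1) e^{ixz}`, whose modulus is at most `2 |z|^α |e^{ixz}|`.
Rescaling by `x` gives the bound, and dominated convergence gives the limit as the integral of
`-z^α e^{iz}`, which a second rotation to the imaginary axis turns into a Gamma integral.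

Since `p` is integrable, Fourier inversion yields `∫ p = 1`, so the normalizing constant tends to
`1`. After the substitution `x = l y`, folding the integral for the `j`-th moment onto `(0, ∞)` only
leaves the part of `g` of the parity of `j`; the tail of `p` and dominated convergence then give
`m_j / (l^j ε) → A μ_j` (`tendsto_moment_div`). For odd `j` the odd part of `g` is `O(ξ)` at `0`,
which is what makes `μ_1` converge when `α ≥ 1`.

For the cumulants, Leibniz' rule applied to `θ' = (log θ)' θ` gives the recursion
`κ_{n+1} = m_{n+1} - ∑_{k<n} (n choose k) κ_{k+1} m_{n-k}` (`cumulant_succ`). By induction every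
term of the sum is a product of two quantities of order `ε`, so cumulants and moments agree to first
order; the same recursion shows that cumulants are real. The standardized cumulants follow by
dividing limits.
-/

noncomputable section

namespace TruncatedLevy

open MeasureTheory Set

/-! ### Contour rotation and the tail of the stable density -/

theorem range_exp_image : Real.exp '' univ = Ioi (0 : ℝ) := by
  rw [image_univ, Real.range_exp]

theorem integral_comp_exp {E : Type*} [NormedAddCommGroup E] [NormedSpace ℝ E] (f : ℝ → E) :
    ∫ t : ℝ, Real.exp t • f (Real.exp t) = ∫ x in Ioi (0 : ℝ), f x := by
  rw [← range_exp_image, integral_image_eq_integral_abs_deriv_smul MeasurableSet.univ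
    (fun x _ => (Real.hasDerivAt_exp x).hasDerivWithinAt) Real.exp_injective.injOn]
  simp [abs_of_pos (Real.exp_pos _)]

theorem integrable_comp_exp {E : Type*} [NormedAddCommGroup E] [NormedSpace ℝ E] (f : ℝ → E) :
    Integrable (fun t : ℝ => Real.exp t • f (Real.exp t)) ↔ IntegrableOn f (Ioi (0 : ℝ)) := by
  rw [← range_exp_image, integrableOn_image_iff_integrableOn_abs_deriv_smul MeasurableSet.univ
    (fun x _ => (Real.hasDerivAt_exp x).hasDerivWithinAt) Real.exp_injective.injOn]
  simp [abs_of_pos (Real.exp_pos _)]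

/-- Contour rotation in logarithmic coordinates: the integral of an entire function over the
horizontal line of height `φ` has derivative `i ∫ H'(t + iφ) dt = 0` in `φ`. -/
theorem integral_horizontal_eq {H H' : ℂ → ℂ} {b : ℝ → ℝ} {φ₀ φ₁ : ℝ} (hφ : φ₀ ≤ φ₁)
    (hH : ∀ z, HasDerivAt H (H' z) z) (hH' : Continuous H') (hb : Integrable b)
    (h₀ : ∀ φ ∈ Icc φ₀ φ₁, ∀ t : ℝ, ‖H (t + φ * Complex.I)‖ ≤ b t)
    (h₁ : ∀ φ ∈ Icc φ₀ φ₁, ∀ t : ℝ, ‖H' (t + φ * Complex.I)‖ ≤ b t) :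
    ∫ t : ℝ, H (t + φ₀ * Complex.I) = ∫ t : ℝ, H (t + φ₁ * Complex.I) := by
  have hc : Continuous H := continuous_iff_continuousAt.2 fun z => (hH z).continuousAt
  have hi : ∀ φ ∈ Icc φ₀ φ₁, Integrable fun t : ℝ => H (t + φ * Complex.I) := fun φ hφ =>
    hb.mono' (by fun_prop) (.of_forall (h₀ φ hφ))
  have hi' : ∀ φ ∈ Icc φ₀ φ₁, Integrable fun t : ℝ => H' (t + φ * Complex.I) := fun φ hφ =>
    hb.mono' (by fun_prop) (.of_forall (h₁ φ hφ))
  have hz : ∀ φ ∈ Icc φ₀ φ₁, ∫ t : ℝ, H' (t + φ * Complex.I) = 0 := by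
    intro φ hφ
    refine integral_eq_zero_of_hasDerivAt_of_integrable (fun t => ?_) (hi' φ hφ) (hi φ hφ)
    exact ((hH (t + φ * Complex.I)).comp_add_const (t : ℂ) (φ * Complex.I)).comp_ofReal
  have hcont : ContinuousOn (fun φ : ℝ => ∫ t : ℝ, H (t + φ * Complex.I)) (Icc φ₀ φ₁) := by
    intro φ hφ
    refine continuousWithinAt_of_dominated (bound := b) ?_ ?_ hb ?_
    · exact .of_forall fun φ => by fun_prop
    · filter_upwards [self_mem_nhdsWithin] with ψ hψ using .of_forall (h₀ ψ hψ)
    · exact .of_forall fun t => by fun_prop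
  have hder : ∀ φ ∈ Ioo φ₀ φ₁, HasDerivAt (fun φ : ℝ => ∫ t : ℝ, H (t + φ * Complex.I)) 0 φ := by
    intro φ hφ
    have h := (hasDerivAt_integral_of_dominated_loc_of_deriv_le (μ := volume) (bound := b)
      (F := fun (φ : ℝ) (t : ℝ) => H (t + φ * Complex.I))
      (F' := fun (φ : ℝ) (t : ℝ) => Complex.I * H' (t + φ * Complex.I)) (x₀ := φ)
      (s := Ioo φ₀ φ₁) (isOpen_Ioo.mem_nhds hφ) (.of_forall fun φ => by fun_prop)
      (hi φ (Ioo_subset_Icc_self hφ)) (by fun_prop) (.of_forall fun t ψ hψ => ?_) hb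
      (.of_forall fun t ψ hψ => ?_)).2
    · -- the derivative in `φ` is `i` times the derivative in `t`, whose integral vanishes
      rwa [integral_const_mul, hz φ (Ioo_subset_Icc_self hφ), mul_zero] at h
    · simpa using h₁ ψ (Ioo_subset_Icc_self hψ) t
    · have h : HasDerivAt (fun z : ℂ => H (t + z * Complex.I))
          (H' (t + ψ * Complex.I) * (1 * Complex.I)) ψ :=
        (hH (t + ψ * Complex.I)).comp (ψ : ℂ)
          (((hasDerivAt_id (ψ : ℂ)).mul_const Complex.I).const_add (t : ℂ))
      rw [one_mul, mul_comm] at h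
      exact h.comp_ofReal
  -- the derivative bound is only available inside the strip; continuity reaches the two ends
  have h := intervalIntegral.integral_eq_sub_of_hasDerivAt_of_le hφ hcont hder
    intervalIntegrable_const
  rw [intervalIntegral.integral_zero] at h
  exact (sub_eq_zero.1 h.symm).symm

theorem integrable_exp_mul_exp_neg {a k c : ℝ} (ha : 0 < a) (hk : 0 < k) (hc : 0 < c) :
    Integrable fun t : ℝ => Real.exp (k * t) * Real.exp (-(c * Real.exp (a * t))) := by
  have h := (integrable_comp_exp _).2
    (integrableOn_rpow_mul_exp_neg_mul_rpow (s := k - 1) (by linarith) ha hc)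
  refine h.congr (.of_forall fun t => ?_)
  simp only [smul_eq_mul, ← Real.exp_mul, ← Real.exp_add]
  ring_nf

/-- `ζ ↦ exp (-exp (αζ) + i x exp ζ) exp ζ`: the integrand of `∫ exp (-q^α + i q x) dq` in the
variable `q = exp ζ`, the Jacobian included. -/
def logKernel (α x : ℝ) (ζ : ℂ) : ℂ :=
  Complex.exp (-Complex.exp (α * ζ) + Complex.I * x * Complex.exp ζ + ζ)

theorem re_exp_mul_add_I (a t φ : ℝ) :
    (Complex.exp (a * (t + φ * Complex.I))).re = Real.exp (a * t) * Real.cos (a * φ) := by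
  rw [Complex.exp_re]; simp

theorem im_exp_add_I (t φ : ℝ) :
    (Complex.exp (t + φ * Complex.I)).im = Real.exp t * Real.sin φ := by
  rw [Complex.exp_im]; simp

theorem norm_exp_mul_add_I (a t φ : ℝ) :
    ‖Complex.exp (a * (t + φ * Complex.I))‖ = Real.exp (a * t) := by
  rw [Complex.norm_exp]; simp

theorem norm_logKernel (α x t φ : ℝ) :
    ‖logKernel α x (t + φ * Complex.I)‖ = Real.exp t *
      Real.exp (-(Real.cos (α * φ) * Real.exp (α * t)) - x * Real.sin φ * Real.exp t) := by
  rw [logKernel, Complex.norm_exp, ← Real.exp_add]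
  congr 1
  rw [Complex.add_re, Complex.add_re, Complex.neg_re, re_exp_mul_add_I, mul_assoc Complex.I,
    Complex.I_mul_re, Complex.im_ofReal_mul, im_exp_add_I]
  simp
  ring

theorem cos_pi_div_four_mul_pos {α : ℝ} (hα₀ : 0 < α) (hα₂ : α < 2) :
    0 < Real.cos (α * (Real.pi / 4)) := by
  have hπ := Real.pi_pos
  exact Real.cos_pos_of_mem_Ioo ⟨by nlinarith, by nlinarith⟩

/-- The ray may be rotated from `arg q = 0` to `arg q = π / 4`: in between, `Re q^α` is at least
`|q|^α cos (απ / 4)`, which is positive as `α < 2`. -/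
theorem integral_logKernel_rotate {α x : ℝ} (hα₀ : 0 < α) (hα₂ : α < 2) (hx : 0 < x) :
    ∫ t : ℝ, logKernel α x t = ∫ t : ℝ, logKernel α x (t + (Real.pi / 4 : ℝ) * Complex.I) := by
  have hπ := Real.pi_pos
  have hc := cos_pi_div_four_mul_pos hα₀ hα₂
  set c := Real.cos (α * (Real.pi / 4)) with hc_def
  let b : ℝ → ℝ := fun t => Real.exp (1 * t) * Real.exp (-(c * Real.exp (α * t)))
    + α * (Real.exp ((α + 1) * t) * Real.exp (-(c * Real.exp (α * t))))
    + x * (Real.exp (2 * t) * Real.exp (-(c * Real.exp (α * t))))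
  have hb : Integrable b :=
    ((integrable_exp_mul_exp_neg hα₀ one_pos hc).add
      ((integrable_exp_mul_exp_neg hα₀ (by linarith) hc).const_mul α)).add
      ((integrable_exp_mul_exp_neg hα₀ two_pos hc).const_mul x)
  let D : ℂ → ℂ := fun ζ => -(Complex.exp (α * ζ) * α) + Complex.I * x * Complex.exp ζ + 1
  have hK : ∀ φ ∈ Icc 0 (Real.pi / 4), ∀ t : ℝ,
      ‖logKernel α x (t + φ * Complex.I)‖ ≤ Real.exp t * Real.exp (-(c * Real.exp (α * t))) := by
    intro φ hφ t
    rw [norm_logKernel]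
    have h1 : c ≤ Real.cos (α * φ) := by
      apply Real.cos_le_cos_of_nonneg_of_le_pi <;> nlinarith [hφ.1, hφ.2]
    have h2 : 0 ≤ Real.sin φ := Real.sin_nonneg_of_nonneg_of_le_pi hφ.1 (by linarith [hφ.2])
    have h3 : 0 ≤ x * Real.sin φ * Real.exp t := by positivity
    have h4 := mul_le_mul_of_nonneg_right h1 (Real.exp_pos (α * t)).le
    gcongr
    linarith
  have hmain := integral_horizontal_eq (H := logKernel α x) (H' := fun ζ => logKernel α x ζ * D ζ)
    (b := b) (φ₀ := 0) (φ₁ := Real.pi / 4) (by positivity) (fun z => ?_)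
    (by unfold logKernel; fun_prop) hb (fun φ hφ t => ?_) (fun φ hφ t => ?_)
  · simpa using hmain
  · have h1 : HasDerivAt (fun z : ℂ => Complex.exp (α * z)) (Complex.exp (α * z) * α) z := by
      simpa using ((hasDerivAt_id z).const_mul (α : ℂ)).cexp
    exact ((h1.neg.add ((Complex.hasDerivAt_exp z).const_mul _)).add (hasDerivAt_id z)).cexp
  · refine (hK φ hφ t).trans ?_
    simp only [b, one_mul]
    have : 0 ≤ α * (Real.exp ((α + 1) * t) * Real.exp (-(c * Real.exp (α * t)))) := by positivity
    have : 0 ≤ x * (Real.exp (2 * t) * Real.exp (-(c * Real.exp (α * t)))) := by positivity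
    linarith
  · have hD : ‖D (t + φ * Complex.I)‖ ≤ Real.exp (α * t) * α + x * Real.exp t + 1 := by
      refine (norm_add_le _ _).trans ?_
      rw [norm_one]
      gcongr
      refine (norm_add_le _ _).trans (le_of_eq ?_)
      have h2 := norm_exp_mul_add_I 1 t φ
      simp only [Complex.ofReal_one, one_mul] at h2
      rw [norm_neg, norm_mul, norm_mul, norm_mul, h2, norm_exp_mul_add_I]
      simp [abs_of_pos hα₀, abs_of_pos hx]
    rw [norm_mul]
    refine (mul_le_mul (hK φ hφ t) hD (norm_nonneg _) (by positivity)).trans (le_of_eq ?_)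
    have e1 : Real.exp ((α + 1) * t) = Real.exp (α * t) * Real.exp t := by
      rw [← Real.exp_add]; ring_nf
    have e2 : Real.exp (2 * t) = Real.exp t * Real.exp t := by
      rw [← Real.exp_add]; ring_nf
    simp only [b, e1, e2, one_mul]
    ring

theorem norm_exp_I_mul_exp (t φ : ℝ) :
    ‖Complex.exp (Complex.I * Complex.exp (t + φ * Complex.I) + (t + φ * Complex.I))‖
      = Real.exp t * Real.exp (-(Real.sin φ * Real.exp t)) := by
  rw [Complex.norm_exp, ← Real.exp_add, Complex.add_re, Complex.I_mul_re, im_exp_add_I]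
  congr 1
  simp
  ring

theorem integrable_logKernel {α x φ : ℝ} (hα₀ : 0 < α) (hx : 0 < x) (hφ : 0 ≤ φ)
    (hφ' : φ ≤ Real.pi) (hc : 0 < Real.cos (α * φ)) :
    Integrable fun t : ℝ => logKernel α x (t + φ * Complex.I) := by
  refine (integrable_exp_mul_exp_neg hα₀ one_pos hc).mono' (by unfold logKernel; fun_prop)
    (.of_forall fun t => ?_)
  have h2 : 0 ≤ Real.sin φ := Real.sin_nonneg_of_nonneg_of_le_pi hφ hφ'
  have h3 : 0 ≤ x * Real.sin φ * Real.exp t := by positivity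
  rw [norm_logKernel, one_mul]
  gcongr
  linarith

/-- The stable density as a half-line integral, written in the logarithmic variable. -/
theorem levyDensity_eq_re_integral {α x : ℝ} (hα₀ : 0 < α) (hx : 0 < x) :
    levyDensity α 1 x = (1 / Real.pi) * (∫ t : ℝ, logKernel α x t).re := by
  have hπ := Real.pi_pos
  have hi : Integrable fun t : ℝ => logKernel α x t := by
    simpa using integrable_logKernel (φ := 0) hα₀ hx le_rfl hπ.le (by simp)
  have h1 := integral_comp_abs (f := fun q => Real.exp (-(q ^ α)) * Real.cos (q * x))
  have h2 : ∀ q : ℝ, Real.cos (|q| * x) = Real.cos (q * x) := fun q => by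
    rw [← Real.cos_abs (q * x), abs_mul, abs_of_pos hx]
  simp only [h2] at h1
  have h3 : (∫ t : ℝ, logKernel α x t).re
      = ∫ q in Ioi (0 : ℝ), Real.exp (-(q ^ α)) * Real.cos (q * x) := by
    rw [← integral_comp_exp]
    refine (integral_re hi).symm.trans (integral_congr_ae (.of_forall fun t => ?_))
    simp only [logKernel, RCLike.re_to_complex, smul_eq_mul]
    rw [← Real.exp_mul, ← mul_assoc, ← Real.exp_add, Complex.exp_re]
    have e1 : Complex.exp (α * t) = (Real.exp (α * t) : ℝ) := by push_cast; rfl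
    have e2 : Complex.exp (t : ℂ) = (Real.exp t : ℝ) := by push_cast; rfl
    rw [e1, e2]
    congr 2
    · simp [-Complex.ofReal_exp]
      ring_nf
    · simp [-Complex.ofReal_exp]
      ring_nf
  rw [levyDensity, h3]
  simp only [Real.one_rpow, one_mul]
  rw [h1, ← mul_assoc]
  congr 1
  field_simp

/-- `(exp (-s z^α) - 1) e^{iz}` in the variable `z = exp ζ`, the Jacobian included. -/
def tailKernel (α s : ℝ) (ζ : ℂ) : ℂ :=
  (Complex.exp (-(s * Complex.exp (α * ζ))) - 1) * Complex.exp (Complex.I * Complex.exp ζ + ζ)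

theorem norm_exp_neg_sub_one_le {w : ℂ} (hw : 0 ≤ w.re) : ‖Complex.exp (-w) - 1‖ ≤ 2 * ‖w‖ := by
  rcases le_total ‖w‖ 1 with h | h
  · simpa using Complex.norm_exp_sub_one_le (x := -w) (by simpa using h)
  · have h1 : ‖Complex.exp (-w)‖ ≤ 1 := by
      rw [Complex.norm_exp]; simpa using hw
    calc ‖Complex.exp (-w) - 1‖ ≤ ‖Complex.exp (-w)‖ + ‖(1 : ℂ)‖ := norm_sub_le _ _
      _ ≤ 2 * ‖w‖ := by rw [norm_one]; linarith

theorem sin_pi_div_four_pos : 0 < Real.sin (Real.pi / 4) := by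
  rw [Real.sin_pi_div_four]; positivity

theorem norm_tailKernel_le {α s : ℝ} (hα₀ : 0 < α) (hα₂ : α < 2) (hs : 0 ≤ s) (t : ℝ) :
    ‖tailKernel α s (t + (Real.pi / 4 : ℝ) * Complex.I)‖ ≤ s * (2 * (Real.exp ((α + 1) * t) *
      Real.exp (-(Real.sin (Real.pi / 4) * Real.exp (1 * t))))) := by
  rw [tailKernel, norm_mul, norm_exp_I_mul_exp]
  have h := norm_exp_neg_sub_one_le
    (w := s * Complex.exp (α * (t + (Real.pi / 4 : ℝ) * Complex.I))) (by
      rw [Complex.re_ofReal_mul, re_exp_mul_add_I]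
      have := cos_pi_div_four_mul_pos hα₀ hα₂
      positivity)
  rw [norm_mul, norm_exp_mul_add_I, Complex.norm_real, Real.norm_of_nonneg hs] at h
  refine (mul_le_mul_of_nonneg_right h (by positivity)).trans (le_of_eq ?_)
  have e1 : Real.exp ((α + 1) * t) = Real.exp (α * t) * Real.exp t := by
    rw [← Real.exp_add]; ring_nf
  rw [e1, one_mul]
  ring

/-- `∫ e^{ixz} dz = i / x` along the ray `arg z = π / 4`, in logarithmic coordinates. -/
theorem integral_exp_I_mul_ray {x : ℝ} (hx : 0 < x) :
    Integrable (fun t : ℝ => Complex.exp (Complex.I * x *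
      Complex.exp (t + (Real.pi / 4 : ℝ) * Complex.I) + (t + (Real.pi / 4 : ℝ) * Complex.I))) ∧
    ∫ t : ℝ, Complex.exp (Complex.I * x * Complex.exp (t + (Real.pi / 4 : ℝ) * Complex.I)
      + (t + (Real.pi / 4 : ℝ) * Complex.I)) = Complex.I / x := by
  set w := Complex.exp ((Real.pi / 4 : ℝ) * Complex.I) with hw
  have hwi : w.im = Real.sin (Real.pi / 4) := by rw [hw, Complex.exp_ofReal_mul_I_im]
  have hre : (Complex.I * x * w).re < 0 := by
    rw [mul_assoc, Complex.I_mul_re, Complex.im_ofReal_mul, hwi]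
    have := sin_pi_div_four_pos
    simpa using mul_pos hx this
  have he : ∀ t : ℝ, Complex.exp (Complex.I * x * Complex.exp (t + (Real.pi / 4 : ℝ) * Complex.I)
      + (t + (Real.pi / 4 : ℝ) * Complex.I))
      = Real.exp t • (Complex.exp (Complex.I * x * w * (Real.exp t : ℝ)) * w) := by
    intro t
    rw [Complex.real_smul, Complex.exp_add, Complex.exp_add, ← hw, Complex.ofReal_exp]
    ring_nf
  simp only [he]
  constructor
  · exact (integrable_comp_exp (fun r : ℝ => Complex.exp (Complex.I * x * w * r) * w)).2
      ((integrableOn_exp_mul_complex_Ioi hre 0).mul_const w)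
  · rw [integral_comp_exp (fun r : ℝ => Complex.exp (Complex.I * x * w * r) * w),
      integral_mul_const, integral_exp_mul_complex_Ioi hre]
    have hw0 : w ≠ 0 := Complex.exp_ne_zero _
    have hx0 : (x : ℂ) ≠ 0 := by exact_mod_cast hx.ne'
    field_simp
    simp

/-- After rotation to the ray `arg = π / 4`, the non-decaying part `∫ e^{iqx} dq = i / x` is
purely imaginary and drops out. -/
theorem levyDensity_eq_tailKernel {α x : ℝ} (hα₀ : 0 < α) (hα₂ : α < 2) (hx : 0 < x) :
    levyDensity α 1 x = (1 / (Real.pi * x)) *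
      (∫ t : ℝ, tailKernel α (x ^ (-α)) (t + (Real.pi / 4 : ℝ) * Complex.I)).re := by
  have hπ := Real.pi_pos
  obtain ⟨hi, hI⟩ := integral_exp_I_mul_ray hx
  have hk := integrable_logKernel (φ := Real.pi / 4) hα₀ hx (by positivity) (by linarith)
    (cos_pi_div_four_mul_pos hα₀ hα₂)
  have hsub := integral_sub hk hi
  rw [hI] at hsub
  have hre : (∫ t : ℝ, logKernel α x t).re = (∫ t : ℝ,
      (logKernel α x (t + (Real.pi / 4 : ℝ) * Complex.I) - Complex.exp (Complex.I * x *
        Complex.exp (t + (Real.pi / 4 : ℝ) * Complex.I)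
          + (t + (Real.pi / 4 : ℝ) * Complex.I)))).re := by
    rw [hsub, integral_logKernel_rotate hα₀ hα₂ hx, Complex.sub_re, Complex.div_ofReal_re]
    simp
  -- translating `t` by `log x` is the scaling `z ↦ z / x`
  rw [levyDensity_eq_re_integral hα₀ hx, hre, ← integral_sub_right_eq_self _ (Real.log x)]
  have hx0 : (x : ℂ) ≠ 0 := by exact_mod_cast hx.ne'
  have hpt : ∀ t : ℝ, (logKernel α x ((t - Real.log x : ℝ) + (Real.pi / 4 : ℝ) * Complex.I)
      - Complex.exp (Complex.I * x *
      Complex.exp ((t - Real.log x : ℝ) + (Real.pi / 4 : ℝ) * Complex.I)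
        + ((t - Real.log x : ℝ) + (Real.pi / 4 : ℝ) * Complex.I)))
      = (x⁻¹ : ℝ) • tailKernel α (x ^ (-α)) (t + (Real.pi / 4 : ℝ) * Complex.I) := by
    intro t
    generalize hζ : (t + (Real.pi / 4 : ℝ) * Complex.I : ℂ) = ζ
    have e0 : ((t - Real.log x : ℝ) + (Real.pi / 4 : ℝ) * Complex.I : ℂ)
        = ζ - (Real.log x : ℝ) := by rw [← hζ]; push_cast; ring
    have e1 : Complex.exp (ζ - (Real.log x : ℝ)) = Complex.exp ζ / x := by
      rw [Complex.exp_sub, ← Complex.ofReal_exp, Real.exp_log hx]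
    have e2 : Complex.exp (α * (ζ - (Real.log x : ℝ)))
        = (x ^ (-α) : ℝ) * Complex.exp (α * ζ) := by
      rw [mul_sub, Complex.exp_sub, ← Complex.ofReal_mul, ← Complex.ofReal_exp, Real.rpow_neg hx.le,
        Real.rpow_def_of_pos hx, mul_comm (Real.log x)]
      push_cast
      field_simp
    rw [e0, logKernel, tailKernel, add_assoc, Complex.exp_add, Complex.exp_add _ (ζ - _), e1, e2,
      Complex.real_smul, Complex.exp_add _ ζ]
    have e3 : Complex.I * x * (Complex.exp ζ / x) = Complex.I * Complex.exp ζ := by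
      field_simp
    rw [e3]
    push_cast
    field_simp
  simp only [hpt]
  rw [integral_smul, Complex.smul_re, smul_eq_mul]
  field_simp

/-- `z^α e^{iz}` in the variable `z = exp ζ`, the Jacobian included. -/
def gammaKernel (α : ℝ) (ζ : ℂ) : ℂ :=
  Complex.exp (((α + 1 : ℝ) : ℂ) * ζ + Complex.I * Complex.exp ζ)

theorem norm_gammaKernel (α t φ : ℝ) : ‖gammaKernel α (t + φ * Complex.I)‖
    = Real.exp ((α + 1) * t) * Real.exp (-(Real.sin φ * Real.exp t)) := by
  rw [gammaKernel, Complex.norm_exp, ← Real.exp_add, Complex.add_re, Complex.I_mul_re,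
    im_exp_add_I, Complex.re_ofReal_mul]
  congr 1
  simp
  ring

theorem integral_gammaKernel_rotate {α : ℝ} (hα₀ : 0 < α) :
    ∫ t : ℝ, gammaKernel α (t + (Real.pi / 4 : ℝ) * Complex.I)
      = ∫ t : ℝ, gammaKernel α (t + (Real.pi / 2 : ℝ) * Complex.I) := by
  have hπ := Real.pi_pos
  have hc := sin_pi_div_four_pos
  set c := Real.sin (Real.pi / 4)
  let b : ℝ → ℝ := fun t =>
    (α + 1 + 1) * (Real.exp ((α + 1) * t) * Real.exp (-(c * Real.exp (1 * t))))
    + Real.exp ((α + 2) * t) * Real.exp (-(c * Real.exp (1 * t)))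
  have hb : Integrable b :=
    ((integrable_exp_mul_exp_neg one_pos (by linarith) hc).const_mul _).add
      (integrable_exp_mul_exp_neg one_pos (by linarith) hc)
  have hK : ∀ φ ∈ Icc (Real.pi / 4) (Real.pi / 2), ∀ t : ℝ, ‖gammaKernel α (t + φ * Complex.I)‖
      ≤ Real.exp ((α + 1) * t) * Real.exp (-(c * Real.exp (1 * t))) := by
    intro φ hφ t
    rw [norm_gammaKernel, one_mul]
    have h1 : c ≤ Real.sin φ :=
      Real.sin_le_sin_of_le_of_le_pi_div_two (by linarith) hφ.2 hφ.1
    gcongr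
  refine integral_horizontal_eq (H := gammaKernel α)
    (H' := fun ζ => gammaKernel α ζ * (((α + 1 : ℝ) : ℂ) + Complex.I * Complex.exp ζ)) (b := b)
    (by linarith) (fun z => ?_) (by unfold gammaKernel; fun_prop) hb (fun φ hφ t => ?_)
    (fun φ hφ t => ?_)
  · have h := (((hasDerivAt_id z).const_mul ((α + 1 : ℝ) : ℂ)).add
      ((Complex.hasDerivAt_exp z).const_mul Complex.I)).cexp
    rwa [mul_one] at h
  · refine (hK φ hφ t).trans ?_
    simp only [b]
    have h1 : 0 ≤ Real.exp ((α + 1) * t) * Real.exp (-(c * Real.exp (1 * t))) := by positivity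
    have h2 : 0 ≤ Real.exp ((α + 2) * t) * Real.exp (-(c * Real.exp (1 * t))) := by positivity
    nlinarith
  · have hD : ‖((α + 1 : ℝ) : ℂ) + Complex.I * Complex.exp (t + φ * Complex.I)‖
        ≤ (α + 1) + Real.exp t := by
      refine (norm_add_le _ _).trans (le_of_eq ?_)
      have h2 := norm_exp_mul_add_I 1 t φ
      simp only [Complex.ofReal_one, one_mul] at h2
      rw [norm_mul, h2, Complex.norm_I, one_mul, Complex.norm_real,
        Real.norm_of_nonneg (by linarith)]
    rw [norm_mul]
    refine (mul_le_mul (hK φ hφ t) hD (norm_nonneg _) (by positivity)).trans ?_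
    have e2 : Real.exp ((α + 2) * t) = Real.exp ((α + 1) * t) * Real.exp t := by
      rw [← Real.exp_add]; ring_nf
    have h1 : 0 ≤ Real.exp ((α + 1) * t) * Real.exp (-(c * Real.exp (1 * t))) := by positivity
    simp only [b, e2]
    linarith

/-- On the imaginary axis the integral of `z^α e^{iz}` is `i^(α + 1) Γ(α + 1)`. -/
theorem re_integral_gammaKernel {α : ℝ} (hα₀ : 0 < α) :
    (∫ t : ℝ, gammaKernel α (t + (Real.pi / 4 : ℝ) * Complex.I)).re
      = -(Real.Gamma (α + 1) * Real.sin (Real.pi * α / 2)) := by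
  have hpt : ∀ t : ℝ, gammaKernel α (t + (Real.pi / 2 : ℝ) * Complex.I)
      = ((Real.exp t * (Real.exp (-Real.exp t) * Real.exp t ^ (α + 1 - 1)) : ℝ) : ℂ)
        * Complex.exp ((((α + 1) * (Real.pi / 2) : ℝ) : ℂ) * Complex.I) := by
    intro t
    have e : Complex.exp (t + (Real.pi / 2 : ℝ) * Complex.I) = Complex.exp t * Complex.I := by
      rw [Complex.exp_add]
      push_cast
      rw [Complex.exp_pi_div_two_mul_I]
    rw [gammaKernel, e, ← Real.exp_mul, ← Real.exp_add, ← Real.exp_add, Complex.ofReal_exp,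
      ← Complex.exp_add]
    congr 1
    have e3 : Complex.I * (Complex.exp t * Complex.I) = -Complex.exp t := by
      linear_combination Complex.exp t * Complex.I_mul_I
    rw [e3]
    push_cast
    ring
  rw [integral_gammaKernel_rotate hα₀]
  simp only [hpt]
  rw [integral_mul_const, integral_complex_ofReal]
  have h := integral_comp_exp fun x : ℝ => Real.exp (-x) * x ^ (α + 1 - 1)
  simp only [smul_eq_mul] at h
  rw [h, ← Real.Gamma_eq_integral (by linarith), Complex.re_ofReal_mul,
    Complex.exp_ofReal_mul_I_re,
    show (α + 1) * (Real.pi / 2) = Real.pi * α / 2 + Real.pi / 2 by ring, Real.cos_add_pi_div_two]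
  ring

/-- The rotated tail integral divided by `s` has a limit as `s → 0`, since
`(exp (-s z^α) - 1) / s → -z^α`. -/
theorem tendsto_integral_tailKernel {α : ℝ} (hα₀ : 0 < α) (hα₂ : α < 2) :
    Tendsto (fun s : ℝ =>
      ∫ t : ℝ, (s⁻¹ : ℝ) • tailKernel α s (t + (Real.pi / 4 : ℝ) * Complex.I)) (𝓝[>] 0)
      (𝓝 (-∫ t : ℝ, gammaKernel α (t + (Real.pi / 4 : ℝ) * Complex.I))) := by
  rw [← integral_neg]
  refine tendsto_integral_filter_of_dominated_convergence
    (fun t => 2 * (Real.exp ((α + 1) * t) *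
      Real.exp (-(Real.sin (Real.pi / 4) * Real.exp (1 * t))))) ?_ ?_ ?_ ?_
  · exact .of_forall fun s => by unfold tailKernel; fun_prop
  · filter_upwards [self_mem_nhdsWithin] with s hs
    refine .of_forall fun t => ?_
    have hs : 0 < s := hs
    rw [norm_smul, Real.norm_of_nonneg (by positivity)]
    calc _ ≤ s⁻¹ * _ :=
          mul_le_mul_of_nonneg_left (norm_tailKernel_le hα₀ hα₂ hs.le t) (by positivity)
      _ = _ := by field_simp
  · exact (integrable_exp_mul_exp_neg one_pos (by linarith) sin_pi_div_four_pos).const_mul 2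
  · refine .of_forall fun t => ?_
    generalize (t + (Real.pi / 4 : ℝ) * Complex.I : ℂ) = ζ
    have h : HasDerivAt (fun s : ℂ => Complex.exp (-(s * Complex.exp (α * ζ))))
        (-Complex.exp (α * ζ)) 0 := by
      simpa using ((hasDerivAt_id (0 : ℂ)).mul_const (Complex.exp (α * ζ))).neg.cexp
    have h2 := (hasDerivAt_iff_tendsto_slope_zero.1 (h.comp_ofReal (z := 0))).mono_left
      (nhdsWithin_mono 0 (fun s (hs : 0 < s) => hs.ne'))
    have h3 := h2.mul_const (Complex.exp (Complex.I * Complex.exp ζ + ζ))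
    refine (h3.congr fun s => ?_).trans (le_of_eq ?_)
    · simp [tailKernel, mul_assoc]
    · rw [gammaKernel, neg_mul, ← Complex.exp_add]
      congr 3
      push_cast
      ring

theorem levyAmplitude_pos {α : ℝ} (hα₀ : 0 < α) (hα₂ : α < 2) : 0 < levyAmplitude α := by
  have hπ := Real.pi_pos
  have h1 := Real.Gamma_pos_of_pos (show 0 < α + 1 by linarith)
  have h2 : 0 < Real.sin (Real.pi * α / 2) :=
    Real.sin_pos_of_pos_of_lt_pi (by positivity) (by nlinarith)
  unfold levyAmplitude
  positivity

/-- The power-law tail of the stable density. -/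
theorem tendsto_levyDensity_tail {α : ℝ} (hα₀ : 0 < α) (hα₂ : α < 2) :
    Tendsto (fun x : ℝ => x ^ (1 + α) * levyDensity α 1 x) atTop (𝓝 (levyAmplitude α / 2)) := by
  have h1 : Tendsto (fun x : ℝ => x ^ (-α)) atTop (𝓝[>] 0) :=
    tendsto_nhdsWithin_iff.2 ⟨tendsto_rpow_neg_atTop hα₀,
      (eventually_gt_atTop 0).mono fun x hx => Real.rpow_pos_of_pos hx _⟩
  have h2 := ((Complex.continuous_re.tendsto _).comp
    ((tendsto_integral_tailKernel hα₀ hα₂).comp h1)).const_mul (1 / Real.pi)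
  rw [Complex.neg_re, re_integral_gammaKernel hα₀] at h2
  refine (h2.congr' ?_).trans (le_of_eq ?_)
  · filter_upwards [eventually_gt_atTop 0] with x hx
    have hπ := Real.pi_pos
    simp only [Function.comp]
    rw [levyDensity_eq_tailKernel hα₀ hα₂ hx, integral_smul, Complex.smul_re, smul_eq_mul,
      Real.rpow_neg hx.le, Real.rpow_add hx, Real.rpow_one, inv_inv]
    field_simp
  · unfold levyAmplitude
    ring_nf

/-- The bound with the exact tail exponent, uniform down to `0`: it gives
`r ^ (-1 - α) * |p (y / r)| ≤ K * y ^ (-1 - α)` for `p = levyDensity α 1`, a majorant independent of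
the scale `r`. -/
theorem abs_levyDensity_le_rpow {α : ℝ} (hα₀ : 0 < α) (hα₂ : α < 2) :
    ∃ K, 0 ≤ K ∧ ∀ x : ℝ, 0 < x → |levyDensity α 1 x| ≤ K * x ^ (-1 - α) := by
  have hπ := Real.pi_pos
  set b : ℝ → ℝ := fun t => 2 * (Real.exp ((α + 1) * t) *
      Real.exp (-(Real.sin (Real.pi / 4) * Real.exp (1 * t))))
  have hb : Integrable b :=
    (integrable_exp_mul_exp_neg one_pos (by linarith) sin_pi_div_four_pos).const_mul 2
  have hb0 : 0 ≤ ∫ t, b t := integral_nonneg fun t => by positivity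
  refine ⟨1 / Real.pi * ∫ t, b t, by positivity, fun x hx => ?_⟩
  have h1 : ‖∫ t : ℝ, tailKernel α (x ^ (-α)) (t + (Real.pi / 4 : ℝ) * Complex.I)‖
      ≤ x ^ (-α) * ∫ t, b t := by
    rw [← integral_const_mul]
    exact norm_integral_le_of_norm_le (hb.const_mul _)
      (.of_forall fun t => norm_tailKernel_le hα₀ hα₂ (Real.rpow_nonneg hx.le _) t)
  rw [levyDensity_eq_tailKernel hα₀ hα₂ hx, abs_mul, abs_of_nonneg (by positivity),
    sub_eq_add_neg, Real.rpow_add hx, Real.rpow_neg_one]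
  calc _ ≤ 1 / (Real.pi * x) * (x ^ (-α) * ∫ t, b t) :=
        mul_le_mul_of_nonneg_left ((Complex.abs_re_le_norm _).trans h1) (by positivity)
    _ = _ := by field_simp

/-! ### Continuity, scaling and total mass of the stable density -/

theorem integrable_of_even {f : ℝ → ℝ} (hf : IntegrableOn f (Ioi 0)) (he : ∀ x, f (-x) = f x) :
    Integrable f := by
  rw [← integrableOn_univ, ← Iic_union_Ioi (a := (0 : ℝ)), integrableOn_union,
    integrableOn_Iic_iff_integrableOn_Iio]
  refine ⟨?_, hf⟩
  have h := IntegrableOn.comp_neg_Iio (c := 0) (f := f) (by simpa using hf)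
  simpa only [he] using h

theorem integrable_exp_neg_mul_abs_rpow {α c : ℝ} (hα₀ : 0 < α) (hc : 0 < c) :
    Integrable fun q : ℝ => Real.exp (-(c * |q| ^ α)) := by
  refine integrable_of_even ?_ fun q => by rw [abs_neg]
  refine (integrableOn_rpow_mul_exp_neg_mul_rpow (s := 0) (by norm_num) hα₀ hc).congr_fun
    (fun q hq => ?_) measurableSet_Ioi
  simp [abs_of_pos (show 0 < q from hq)]

theorem continuous_exp_neg_mul_abs_rpow {α : ℝ} (hα₀ : 0 < α) (c : ℝ) :
    Continuous fun q : ℝ => Real.exp (-(c * |q| ^ α)) :=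
  Real.continuous_exp.comp
    ((continuous_const.mul (continuous_abs.rpow_const fun _ => Or.inr hα₀.le)).neg)

theorem continuous_levyDensity {α γ : ℝ} (hα₀ : 0 < α) (hγ : 0 < γ) :
    Continuous (levyDensity α γ) := by
  refine continuous_const.mul (continuous_of_dominated
    (bound := fun q => Real.exp (-(γ ^ α * |q| ^ α))) (fun x => ?_) (fun x => ?_)
    (integrable_exp_neg_mul_abs_rpow hα₀ (by positivity)) (.of_forall fun q => by fun_prop))
  · exact ((continuous_exp_neg_mul_abs_rpow hα₀ _).mul (by fun_prop)).aestronglyMeasurable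
  · refine .of_forall fun q => ?_
    rw [norm_mul, Real.norm_of_nonneg (Real.exp_pos _).le]
    exact mul_le_of_le_one_right (Real.exp_pos _).le (Real.abs_cos_le_one _)

theorem exists_abs_levyDensity_le {α γ : ℝ} (hα₀ : 0 < α) (hγ : 0 < γ) :
    ∃ B, 0 ≤ B ∧ ∀ x, |levyDensity α γ x| ≤ B := by
  have hπ := Real.pi_pos
  have h0 : 0 ≤ ∫ q : ℝ, Real.exp (-(γ ^ α * |q| ^ α)) := integral_nonneg fun q => by positivity
  refine ⟨1 / (2 * Real.pi) * ∫ q : ℝ, Real.exp (-(γ ^ α * |q| ^ α)), by positivity, fun x => ?_⟩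
  rw [levyDensity, abs_mul, abs_of_nonneg (by positivity), ← Real.norm_eq_abs]
  refine mul_le_mul_of_nonneg_left (norm_integral_le_of_norm_le
    (integrable_exp_neg_mul_abs_rpow hα₀ (Real.rpow_pos_of_pos hγ α)) (.of_forall fun q => ?_))
    (by positivity)
  rw [norm_mul, Real.norm_of_nonneg (Real.exp_pos _).le]
  exact mul_le_of_le_one_right (Real.exp_pos _).le (Real.abs_cos_le_one _)

theorem levyDensity_neg (α γ x : ℝ) : levyDensity α γ (-x) = levyDensity α γ x := by
  simp [levyDensity]

theorem levyDensity_eq_scale (α : ℝ) {γ : ℝ} (hγ : 0 < γ) (x : ℝ) :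
    levyDensity α γ x = γ⁻¹ * levyDensity α 1 (x / γ) := by
  have h := Measure.integral_comp_mul_left
    (fun q : ℝ => Real.exp (-(1 ^ α * |q| ^ α)) * Real.cos (q * (x / γ))) γ
  rw [abs_of_pos (inv_pos.2 hγ), smul_eq_mul] at h
  rw [levyDensity, levyDensity, mul_left_comm, ← h]
  congr 2
  ext q
  rw [abs_mul, abs_of_pos hγ, Real.mul_rpow hγ.le (abs_nonneg q), Real.one_rpow, one_mul]
  congr 2
  field_simp

theorem integrable_levyDensity_one {α : ℝ} (hα₀ : 0 < α) (hα₂ : α < 2) :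
    Integrable (levyDensity α 1) := by
  obtain ⟨K, hK, h⟩ := abs_levyDensity_le_rpow hα₀ hα₂
  refine (continuous_levyDensity hα₀ one_pos).locallyIntegrable
    |>.integrable_of_isBigO_atTop_of_norm_isNegInvariant (g := fun x : ℝ => x ^ (-1 - α)) ?_ ?_ ?_
  · exact .of_forall fun x => by simp [levyDensity_neg]
  · refine IsBigO.of_bound K ((eventually_gt_atTop 0).mono fun x hx => ?_)
    rw [Real.norm_of_nonneg (Real.rpow_nonneg hx.le _)]
    exact h x hx
  · exact ⟨Ioi 1, Ioi_mem_atTop 1, integrableOn_Ioi_rpow_of_lt (by linarith) one_pos⟩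

theorem integral_eq_zero_of_odd {f : ℝ → ℝ} (h : ∀ x, f (-x) = -f x) : ∫ x, f x = 0 := by
  have h1 := integral_neg_eq_self f volume
  simp only [h, integral_neg] at h1
  linarith

/-- The factor `1 ^ α` is `γ ^ α` at scale `γ = 1`, as in the definition of `levyDensity`. -/
theorem fourier_exp_neg_abs_rpow {α : ℝ} (hα₀ : 0 < α) (w : ℝ) :
    FourierTransform.fourier (fun q : ℝ => ((Real.exp (-(1 ^ α * |q| ^ α)) : ℝ) : ℂ)) w
      = ((2 * Real.pi * levyDensity α 1 (2 * Real.pi * w) : ℝ) : ℂ) := by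
  have hπ := Real.pi_pos
  have hf := integrable_exp_neg_mul_abs_rpow hα₀ (c := 1 ^ α) (by simp)
  have hfc := continuous_exp_neg_mul_abs_rpow hα₀ (1 ^ α)
  set f : ℝ → ℝ := fun q => Real.exp (-(1 ^ α * |q| ^ α)) with hf_def
  have hc : Integrable fun q : ℝ => f q * Real.cos (q * (2 * Real.pi * w)) :=
    hf.mono (hfc.mul (by fun_prop)).aestronglyMeasurable (.of_forall fun q => by
      rw [norm_mul]
      exact mul_le_of_le_one_right (norm_nonneg _) (Real.abs_cos_le_one _))
  have hs : Integrable fun q : ℝ => f q * Real.sin (q * (2 * Real.pi * w)) :=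
    hf.mono (hfc.mul (by fun_prop)).aestronglyMeasurable (.of_forall fun q => by
      rw [norm_mul]
      exact mul_le_of_le_one_right (norm_nonneg _) (Real.abs_sin_le_one _))
  rw [Real.fourier_real_eq_integral_exp_smul]
  have hpt : ∀ q : ℝ, Complex.exp (↑(-2 * Real.pi * q * w) * Complex.I) • (f q : ℂ)
      = ((f q * Real.cos (q * (2 * Real.pi * w)) : ℝ) : ℂ)
        - ((f q * Real.sin (q * (2 * Real.pi * w)) : ℝ) : ℂ) * Complex.I := by
    intro q
    rw [Complex.exp_mul_I, ← Complex.ofReal_cos, ← Complex.ofReal_sin,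
      show -2 * Real.pi * q * w = -(q * (2 * Real.pi * w)) by ring, Real.cos_neg, Real.sin_neg,
      smul_eq_mul]
    push_cast
    ring
  refine (integral_congr_ae (.of_forall hpt)).trans ?_
  rw [integral_sub hc.ofReal (hs.ofReal.mul_const _), integral_mul_const, integral_complex_ofReal,
    integral_complex_ofReal, integral_eq_zero_of_odd
      (f := fun q => f q * Real.sin (q * (2 * Real.pi * w)))
      (fun q => by simp [hf_def, neg_mul])]
  simp only [Complex.ofReal_zero, zero_mul, sub_zero, levyDensity]
  rw [← mul_assoc, mul_one_div_cancel (by positivity), one_mul]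

/-- Fourier inversion at the origin. -/
theorem integral_levyDensity_one {α : ℝ} (hα₀ : 0 < α) (hα₂ : α < 2) :
    ∫ x, levyDensity α 1 x = 1 := by
  have hπ := Real.pi_pos
  have hf := integrable_exp_neg_mul_abs_rpow hα₀ (c := 1 ^ α) (by simp)
  have hfc := continuous_exp_neg_mul_abs_rpow hα₀ (1 ^ α)
  have hF := funext (fourier_exp_neg_abs_rpow hα₀)
  have hi : Integrable (fun w : ℝ => 2 * Real.pi * levyDensity α 1 (2 * Real.pi * w)) :=
    ((integrable_levyDensity_one hα₀ hα₂).comp_mul_left' (by positivity)).const_mul _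
  have h := hf.ofReal.fourierInv_fourier_eq (v := 0)
    (by simp only [Function.comp_def, hF]; exact hi.ofReal)
    (Complex.continuous_ofReal.comp hfc).continuousAt
  simp only [Function.comp_def] at h
  rw [hF, Real.fourierInv_eq'] at h
  simp only [inner_zero_right, mul_zero, Complex.ofReal_zero, zero_mul, Complex.exp_zero,
    one_smul] at h
  rw [integral_complex_ofReal, integral_const_mul, Measure.integral_comp_mul_left] at h
  have h2 := Complex.ofReal_injective (h.trans (by simp [hα₀.ne'] : _ = ((1 : ℝ) : ℂ)))
  rw [abs_of_pos (by positivity), smul_eq_mul] at h2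
  rwa [mul_inv_cancel_left₀ (by positivity)] at h2

/-! ### The Mellin transforms of the parity parts -/

theorem continuous_parityPart (g : SchwartzMap ℝ ℝ) (j : ℕ) : Continuous (parityPart g j) := by
  have hg := g.continuous
  unfold parityPart
  split_ifs <;> fun_prop

theorem add_neg_one_pow_mul_eq_parityPart (g : ℝ → ℝ) (j : ℕ) (ξ : ℝ) :
    g ξ + (-1) ^ j * g (-ξ) = 2 * parityPart g j ξ := by
  unfold parityPart
  split_ifs with h
  · rw [h.neg_one_pow]; ring
  · rw [(Nat.not_even_iff_odd.1 h).neg_one_pow]; ring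

theorem parityPart_isBigO_atTop (g : SchwartzMap ℝ ℝ) (j : ℕ) (s : ℝ) :
    parityPart g j =O[atTop] fun ξ : ℝ => ξ ^ s := by
  have h := g.isBigO_cocompact_rpow s
  have h1 : (fun ξ => g ξ) =O[atTop] fun ξ : ℝ => ‖ξ‖ ^ s := h.mono atTop_le_cocompact
  have h2 : (fun ξ => g (-ξ)) =O[atTop] fun ξ : ℝ => ‖ξ‖ ^ s := by
    have := (h.mono atBot_le_cocompact).comp_tendsto tendsto_neg_atTop_atBot
    simpa [Function.comp_def] using this
  have h3 : parityPart g j =O[atTop] fun ξ : ℝ => ‖ξ‖ ^ s := by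
    have h4 := (h1.add (h2.const_mul_left ((-1) ^ j))).const_mul_left (1 / 2)
    refine h4.congr_left fun ξ => ?_
    rw [add_neg_one_pow_mul_eq_parityPart]
    ring
  refine h3.congr' .rfl ((eventually_gt_atTop 0).mono fun ξ hξ => ?_)
  simp only [Real.norm_of_nonneg hξ.le]

theorem parityPart_isBigO_zero_of_odd (g : SchwartzMap ℝ ℝ) {j : ℕ} (hj : Odd j) :
    parityPart g j =O[𝓝[>] 0] fun ξ : ℝ => ξ ^ (1 : ℝ) := by
  have hd : DifferentiableAt ℝ (parityPart g j) 0 := by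
    have hg : Differentiable ℝ g := g.differentiable
    unfold parityPart
    simp only [if_neg (Nat.not_even_iff_odd.2 hj)]
    fun_prop
  have h := hd.isBigO_sub
  have h0 : parityPart g j 0 = 0 := by simp [parityPart, Nat.not_even_iff_odd.2 hj]
  simp only [h0, sub_zero] at h
  exact (h.mono nhdsWithin_le_nhds).congr_right fun ξ => (Real.rpow_one ξ).symm

theorem parityPart_isBigO_zero (g : SchwartzMap ℝ ℝ) (j : ℕ) :
    parityPart g j =O[𝓝[>] 0] fun ξ : ℝ => ξ ^ (0 : ℝ) := by
  have h := ((continuous_parityPart g j).continuousAt (x := 0)).isBigO_one ℝ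
  exact (h.mono nhdsWithin_le_nhds).congr_right fun ξ => (Real.rpow_zero ξ).symm

/-- At `0` the bound `O(1)` suffices for even `j ≥ 2`; for odd `j` the odd part gains one power of
`ξ`, which is needed for `j = 1 ≤ α`. -/
theorem mellinConvergent_parityPart {α : ℝ} (hα₀ : 0 < α) (hα₂ : α < 2) (g : SchwartzMap ℝ ℝ)
    {j : ℕ} (hj : 1 ≤ j) :
    MellinConvergent (fun ξ : ℝ => (parityPart g j ξ : ℂ)) ((j : ℂ) - (α : ℂ)) := by
  have hre : ((j : ℂ) - (α : ℂ)).re = j - α := by simp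
  have hloc : LocallyIntegrableOn (fun ξ : ℝ => (parityPart g j ξ : ℂ)) (Ioi 0) :=
    (Complex.continuous_ofReal.comp (continuous_parityPart g j)).locallyIntegrable
      |>.locallyIntegrableOn _
  have htop : (fun ξ : ℝ => (parityPart g j ξ : ℂ)) =O[atTop] fun ξ : ℝ => ξ ^ (-(j : ℝ)) :=
    Complex.isBigO_ofReal_left.2 (parityPart_isBigO_atTop g j _)
  rcases Nat.even_or_odd j with h | h
  · refine mellinConvergent_of_isBigO_rpow (a := j) (b := 0) hloc htop (by rw [hre]; linarith) ?_ ?_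
    · rw [neg_zero]
      exact Complex.isBigO_ofReal_left.2 (parityPart_isBigO_zero g j)
    · have : 2 ≤ j := by rcases h with ⟨k, hk⟩; omega
      have : (2 : ℝ) ≤ j := by exact_mod_cast this
      rw [hre]; linarith
  · refine mellinConvergent_of_isBigO_rpow (a := j) (b := -1) hloc htop
      (by rw [hre]; linarith) ?_ ?_
    · rw [neg_neg]
      exact Complex.isBigO_ofReal_left.2 (parityPart_isBigO_zero_of_odd g h)
    · have : (1 : ℝ) ≤ j := by exact_mod_cast hj
      rw [hre]; linarith

theorem cpow_smul_parityPart {α ξ : ℝ} (hξ : 0 < ξ) (g : ℝ → ℝ) (j : ℕ) :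
    (ξ : ℂ) ^ ((j : ℂ) - (α : ℂ) - 1) • (parityPart g j ξ : ℂ)
      = ((ξ ^ ((j : ℝ) - 1 - α) * parityPart g j ξ : ℝ) : ℂ) := by
  rw [Complex.ofReal_mul, Complex.ofReal_cpow hξ.le, smul_eq_mul]
  push_cast
  ring_nf

theorem integrableOn_rpow_mul_parityPart {α : ℝ} (hα₀ : 0 < α) (hα₂ : α < 2) (g : SchwartzMap ℝ ℝ)
    {j : ℕ} (hj : 1 ≤ j) :
    IntegrableOn (fun ξ : ℝ => ξ ^ ((j : ℝ) - 1 - α) * parityPart g j ξ) (Ioi 0) := by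
  have h := (mellinConvergent_parityPart hα₀ hα₂ g hj).congr_fun
    (fun ξ hξ => cpow_smul_parityPart hξ g j) measurableSet_Ioi
  simpa [IntegrableOn] using h.re

theorem hasMellin_parityPart {α : ℝ} (hα₀ : 0 < α) (hα₂ : α < 2) (g : SchwartzMap ℝ ℝ)
    {j : ℕ} (hj : 1 ≤ j) :
    HasMellin (fun ξ : ℝ => (parityPart g j ξ : ℂ)) ((j : ℂ) - (α : ℂ))
      (truncMellin α g j : ℂ) := by
  refine ⟨mellinConvergent_parityPart hα₀ hα₂ g hj, ?_⟩
  rw [mellin, setIntegral_congr_fun measurableSet_Ioi fun ξ hξ => cpow_smul_parityPart hξ g j,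
    integral_complex_ofReal, truncMellin]

theorem truncMellin_pos {α : ℝ} (hα₀ : 0 < α) (hα₂ : α < 2) (g : SchwartzMap ℝ ℝ) (hg₀ : g 0 = 1)
    (hg : ∀ x, 0 ≤ g x) {j : ℕ} (hj : 1 ≤ j) (he : Even j) : 0 < truncMellin α g j := by
  have hnn : ∀ ξ, 0 ≤ parityPart g j ξ := fun ξ => by
    rw [parityPart, if_pos he]
    have h1 := hg ξ
    have h2 := hg (-ξ)
    positivity
  rw [truncMellin, setIntegral_pos_iff_support_of_nonneg_ae ?_
    (integrableOn_rpow_mul_parityPart hα₀ hα₂ g hj)]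
  · have h0 : 0 < parityPart g j 0 := by simp [parityPart, he, hg₀]
    obtain ⟨δ, hδ, h⟩ := Metric.eventually_nhds_iff.1
      ((continuous_parityPart g j).continuousAt.eventually_const_lt h0)
    have hsub : Ioo 0 δ ⊆ Function.support (fun ξ : ℝ => ξ ^ ((j : ℝ) - 1 - α) * parityPart g j ξ)
        ∩ Ioi 0 := fun ξ hξ => by
      have h1 := h (y := ξ) (by rw [Real.dist_eq, sub_zero, abs_of_pos hξ.1]; exact hξ.2)
      exact ⟨(mul_pos (Real.rpow_pos_of_pos hξ.1 _) h1).ne', hξ.1⟩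
    refine lt_of_lt_of_le ?_ (measure_mono hsub)
    simpa using hδ
  · filter_upwards [self_mem_ae_restrict measurableSet_Ioi] with ξ hξ
    exact mul_nonneg (Real.rpow_nonneg (le_of_lt hξ) _) (hnn ξ)

/-! ### Moments in units of the truncation length -/

/-- The `j`-th moment of the unnormalized truncated density `levyDensity α r y * g y` with
truncation length `1`; the general case reduces to it with `r = γ / l`. -/
def rawMoment (α : ℝ) (g : ℝ → ℝ) (j : ℕ) (r : ℝ) : ℝ :=
  ∫ y : ℝ, y ^ j * (levyDensity α r y * g y)

theorem integrable_pow_mul_levyDensity {α γ l : ℝ} (hα₀ : 0 < α) (hγ : 0 < γ) (hl : 0 < l)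
    (g : SchwartzMap ℝ ℝ) (j : ℕ) :
    Integrable fun x : ℝ => x ^ j * (levyDensity α γ x * g (x / l)) := by
  obtain ⟨B, hB, h⟩ := exists_abs_levyDensity_le hα₀ hγ
  have hc := continuous_levyDensity hα₀ hγ
  have hg := g.continuous
  have h1 : Integrable fun x : ℝ => ‖x / l‖ ^ j * ‖g (x / l)‖ :=
    (g.integrable_pow_mul volume j).comp_div hl.ne'
  refine (h1.const_mul (B * l ^ j)).mono' (by fun_prop) (.of_forall fun x => ?_)
  rw [norm_mul, norm_mul, norm_pow, norm_div, Real.norm_of_nonneg hl.le, div_pow]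
  calc _ ≤ ‖x‖ ^ j * (B * ‖g (x / l)‖) := by
        gcongr
        exact h x
    _ = _ := by field_simp

theorem integral_pow_mul_levyDensity {α γ l : ℝ} (hγ : 0 < γ) (hl : 0 < l) (g : ℝ → ℝ) (j : ℕ) :
    ∫ x : ℝ, x ^ j * (levyDensity α γ x * g (x / l)) = l ^ j * rawMoment α g j (γ / l) := by
  have h := Measure.integral_comp_mul_left
    (fun x : ℝ => x ^ j * (levyDensity α γ x * g (x / l))) l
  rw [abs_of_pos (inv_pos.2 hl), smul_eq_mul, eq_inv_mul_iff_mul_eq₀ hl.ne'] at h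
  rw [← h, rawMoment, ← integral_const_mul, ← integral_const_mul]
  congr 1
  ext y
  rw [levyDensity_eq_scale α hγ, levyDensity_eq_scale α (div_pos hγ hl)]
  have e1 : l * y / l = y := by field_simp
  have e2 : l * y / γ = y / (γ / l) := by field_simp
  rw [e1, e2, mul_pow]
  field_simp

theorem normConst_eq {α γ l : ℝ} (hγ : 0 < γ) (hl : 0 < l) (g : ℝ → ℝ) :
    normConst α γ l g = (rawMoment α g 0 (γ / l))⁻¹ := by
  have h := integral_pow_mul_levyDensity (α := α) hγ hl g 0
  simp only [pow_zero, one_mul] at h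
  rw [normConst, h]

theorem pow_mul_truncDensity (α γ l : ℝ) (g : ℝ → ℝ) (j : ℕ) (x : ℝ) :
    x ^ j * truncDensity α γ l g x
      = normConst α γ l g * (x ^ j * (levyDensity α γ x * g (x / l))) := by
  rw [truncDensity]; ring

theorem integrable_pow_mul_truncDensity {α γ l : ℝ} (hα₀ : 0 < α) (hγ : 0 < γ) (hl : 0 < l)
    (g : SchwartzMap ℝ ℝ) (j : ℕ) : Integrable fun x : ℝ => x ^ j * truncDensity α γ l g x := by
  simp only [pow_mul_truncDensity]
  exact (integrable_pow_mul_levyDensity hα₀ hγ hl g j).const_mul _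

theorem moment_truncDensity {α γ l : ℝ} (hγ : 0 < γ) (hl : 0 < l) (g : ℝ → ℝ) (j : ℕ) :
    moment (truncDensity α γ l g) j
      = l ^ j * ((rawMoment α g 0 (γ / l))⁻¹ * rawMoment α g j (γ / l)) := by
  rw [moment]
  simp only [pow_mul_truncDensity]
  rw [integral_const_mul, integral_pow_mul_levyDensity hγ hl, normConst_eq hγ hl]
  ring

/-- The total mass `∫ p(z) g(r z) dz` tends to `g 0 ∫ p = 1`. -/
theorem tendsto_rawMoment_zero {α : ℝ} (hα₀ : 0 < α) (hα₂ : α < 2) (g : SchwartzMap ℝ ℝ)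
    (hg₀ : g 0 = 1) : Tendsto (rawMoment α g 0) (𝓝[>] 0) (𝓝 1) := by
  have hp := integrable_levyDensity_one hα₀ hα₂
  have hpc := continuous_levyDensity hα₀ one_pos
  have hgc := g.continuous
  obtain ⟨B, hB⟩ : ∃ B, ∀ x, ‖g x‖ ≤ B :=
    ⟨‖g.toBoundedContinuousFunction‖, fun x => g.toBoundedContinuousFunction.norm_coe_le_norm x⟩
  have h : Tendsto (fun r : ℝ => ∫ z, levyDensity α 1 z * g (r * z)) (𝓝[>] 0)
      (𝓝 (∫ z, levyDensity α 1 z * 1)) := by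
    refine tendsto_integral_filter_of_dominated_convergence (fun z => B * ‖levyDensity α 1 z‖)
      (.of_forall fun r => by fun_prop) (.of_forall fun r => .of_forall fun z => ?_)
      (hp.norm.const_mul B) (.of_forall fun z => ?_)
    · rw [norm_mul, mul_comm]
      gcongr
      exact hB _
    · have hcont : Continuous fun r : ℝ => levyDensity α 1 z * g (r * z) := by fun_prop
      have := (hcont.tendsto 0).mono_left (nhdsWithin_le_nhds (s := Ioi 0))
      rwa [zero_mul, hg₀] at this
  simp only [mul_one, integral_levyDensity_one hα₀ hα₂] at h
  refine h.congr' ?_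
  filter_upwards [self_mem_nhdsWithin] with r hr
  have hr : 0 < r := hr
  have h2 := Measure.integral_comp_div (fun z : ℝ => levyDensity α 1 z * g (r * z)) r
  rw [abs_of_pos hr, smul_eq_mul] at h2
  rw [rawMoment, ← mul_right_injective₀ hr.ne' |>.eq_iff, ← h2, ← integral_const_mul]
  congr 1
  ext y
  rw [levyDensity_eq_scale α hr, mul_div_cancel₀ y hr.ne']
  field_simp

theorem integral_eq_integral_Ioi_add_neg {f : ℝ → ℝ} (hf : Integrable f) :
    ∫ x, f x = ∫ x in Ioi (0 : ℝ), (f x + f (-x)) := by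
  rw [integral_add hf.integrableOn hf.comp_neg.integrableOn, integral_comp_neg_Ioi, neg_zero,
    add_comm]
  exact (intervalIntegral.integral_Iic_add_Ioi hf.integrableOn hf.integrableOn).symm

/-- The `j`-th moment is of order `r ^ α`: after folding onto `(0, ∞)` the integrand is
`2 (y / r)^(1 + α) p(y / r) y^(j - 1 - α) g_j(y)`, where the factor depending on `r` is bounded and
tends to `levyAmplitude α`. -/
theorem tendsto_rawMoment {α : ℝ} (hα₀ : 0 < α) (hα₂ : α < 2) (g : SchwartzMap ℝ ℝ) {j : ℕ}
    (hj : 1 ≤ j) : Tendsto (fun r : ℝ => (r ^ α)⁻¹ * rawMoment α g j r) (𝓝[>] 0)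
      (𝓝 (levyAmplitude α * truncMellin α g j)) := by
  obtain ⟨K, hK, hb⟩ := abs_levyDensity_le_rpow hα₀ hα₂
  have hint := integrableOn_rpow_mul_parityPart hα₀ hα₂ g hj
  have hpar := continuous_parityPart g j
  have key : ∀ r : ℝ, 0 < r → (r ^ α)⁻¹ * rawMoment α g j r = ∫ y in Ioi (0 : ℝ),
      2 * ((y / r) ^ (1 + α) * levyDensity α 1 (y / r)) *
        (y ^ ((j : ℝ) - 1 - α) * parityPart g j y) := by
    intro r hr
    have hi := integrable_pow_mul_levyDensity hα₀ hr one_pos g j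
    simp only [div_one] at hi
    rw [rawMoment, integral_eq_integral_Ioi_add_neg hi, ← integral_const_mul]
    refine setIntegral_congr_fun measurableSet_Ioi fun y hy => ?_
    have hy : 0 < y := hy
    have e1 : y ^ j * (levyDensity α r y * g y) + (-y) ^ j * (levyDensity α r (-y) * g (-y))
        = y ^ j * levyDensity α r y * (2 * parityPart g j y) := by
      rw [← add_neg_one_pow_mul_eq_parityPart, levyDensity_neg, neg_pow y j]
      ring
    have e2 : y ^ ((j : ℝ) - 1 - α) = y ^ j * (y ^ (1 + α))⁻¹ := by
      rw [← Real.rpow_natCast y j, ← Real.rpow_neg hy.le, ← Real.rpow_add hy]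
      ring_nf
    have e3 : r ^ (1 + α) = r * r ^ α := by rw [Real.rpow_add hr, Real.rpow_one]
    have hy1 := Real.rpow_pos_of_pos hy (1 + α)
    have hr1 := Real.rpow_pos_of_pos hr α
    simp only [e1]
    rw [levyDensity_eq_scale α hr, Real.div_rpow hy.le hr.le, e2, e3]
    field_simp
  have hlim : levyAmplitude α * truncMellin α g j = ∫ y in Ioi (0 : ℝ),
      2 * (levyAmplitude α / 2) * (y ^ ((j : ℝ) - 1 - α) * parityPart g j y) := by
    rw [integral_const_mul, truncMellin]
    ring
  rw [hlim]
  refine Tendsto.congr' (eventually_nhdsWithin_of_forall fun r hr => (key r hr).symm) ?_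
  refine tendsto_integral_filter_of_dominated_convergence
    (fun y => 2 * K * ‖y ^ ((j : ℝ) - 1 - α) * parityPart g j y‖) ?_ ?_ (hint.norm.const_mul _) ?_
  · have hp := continuous_levyDensity hα₀ one_pos
    refine .of_forall fun r => Measurable.aestronglyMeasurable ?_
    fun_prop
  · filter_upwards [self_mem_nhdsWithin] with r hr
    filter_upwards [self_mem_ae_restrict measurableSet_Ioi] with y hy
    have hyr : 0 < y / r := div_pos hy hr
    rw [norm_mul, norm_mul, Real.norm_two, norm_mul,
      Real.norm_of_nonneg (Real.rpow_nonneg hyr.le _)]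
    have h1 : (y / r) ^ (1 + α) * ‖levyDensity α 1 (y / r)‖ ≤ K := by
      calc _ ≤ (y / r) ^ (1 + α) * (K * (y / r) ^ (-1 - α)) :=
            mul_le_mul_of_nonneg_left (hb _ hyr) (Real.rpow_nonneg hyr.le _)
        _ = K * ((y / r) ^ (1 + α) * (y / r) ^ (-1 - α)) := by ring
        _ = K := by rw [← Real.rpow_add hyr]; simp
    gcongr
  · filter_upwards [self_mem_ae_restrict measurableSet_Ioi] with y hy
    have hdiv : Tendsto (fun r : ℝ => y / r) (𝓝[>] 0) atTop := by
      simpa only [div_eq_mul_inv] using tendsto_inv_nhdsGT_zero.const_mul_atTop hy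
    exact (((tendsto_levyDensity_tail hα₀ hα₂).comp hdiv).const_mul 2).mul_const _

/-! ### Moments and cumulants of a density -/

theorem charFn_eq_fourier (P : ℝ → ℝ) :
    charFn P = fun q => FourierTransform.fourier (fun x => (P x : ℂ)) (-(2 * Real.pi)⁻¹ * q) := by
  have hπ := Real.pi_pos
  ext q
  rw [charFn, Real.fourier_real_eq_integral_exp_smul]
  congr 1
  ext x
  rw [smul_eq_mul]
  congr 2
  have h : -2 * Real.pi * x * (-(2 * Real.pi)⁻¹ * q) = q * x := by field_simp
  rw [h]
  push_cast
  ring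

theorem contDiff_fourier_of_moments {P : ℝ → ℝ} (hP : ∀ n : ℕ, Integrable fun x => x ^ n * P x) :
    ContDiff ℝ ∞ (FourierTransform.fourier fun x => (P x : ℂ)) :=
  Real.contDiff_fourier (N := ⊤) fun n _ => by
    simpa [norm_mul, norm_pow] using (hP n).norm

theorem contDiff_charFn {P : ℝ → ℝ} (hP : ∀ n : ℕ, Integrable fun x => x ^ n * P x) :
    ContDiff ℝ ∞ (charFn P) := by
  rw [charFn_eq_fourier]
  exact (contDiff_fourier_of_moments hP).comp (contDiff_const.mul contDiff_id)

theorem charFn_zero (P : ℝ → ℝ) : charFn P 0 = ((∫ x, P x : ℝ) : ℂ) := by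
  simp [charFn, integral_complex_ofReal]

theorem iteratedDeriv_charFn_zero {P : ℝ → ℝ} (hP : ∀ n : ℕ, Integrable fun x => x ^ n * P x)
    (n : ℕ) : iteratedDeriv n (charFn P) 0 = Complex.I ^ n * moment P n := by
  have hπ : (Real.pi : ℂ) ≠ 0 := by exact_mod_cast Real.pi_ne_zero
  have hP' : ∀ m : ℕ, (m : ℕ∞) ≤ ⊤ → Integrable fun x : ℝ => x ^ m • (P x : ℂ) := fun m _ => by
    simpa using (hP m).ofReal (𝕜 := ℂ)
  rw [charFn_eq_fourier, iteratedDeriv_comp_const_smul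
    ((contDiff_fourier_of_moments hP).of_le (by exact_mod_cast le_top)),
    Real.iteratedDeriv_fourier hP' le_top]
  beta_reduce
  rw [Real.fourier_real_eq_integral_exp_smul, moment,
    ← integral_complex_ofReal, ← integral_const_mul, ← integral_smul]
  congr 1
  ext x
  simp only [mul_zero, Complex.ofReal_zero, zero_mul, Complex.exp_zero, smul_eq_mul,
    Complex.real_smul]
  push_cast
  rw [one_mul, ← mul_assoc, ← mul_assoc, ← mul_pow, ← mul_pow]
  congr 2
  field_simp

theorem charFn_zero_mem_slitPlane {P : ℝ → ℝ} (h1 : ∫ x, P x = 1) :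
    charFn P 0 ∈ Complex.slitPlane := by
  rw [charFn_zero, h1, Complex.ofReal_one]
  exact Complex.one_mem_slitPlane

theorem contDiffAt_log_charFn {P : ℝ → ℝ} (hP : ∀ n : ℕ, Integrable fun x => x ^ n * P x)
    (h1 : ∫ x, P x = 1) : ContDiffAt ℝ ∞ (fun q : ℝ => Complex.log (charFn P q)) 0 :=
  ((Complex.contDiffAt_log (charFn_zero_mem_slitPlane h1)).restrict_scalars ℝ).comp (0 : ℝ)
    (contDiff_charFn hP).contDiffAt

/-- The moment-cumulant recursion, obtained by Leibniz' rule from `θ' = (log θ)' θ`. -/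
theorem moment_succ_eq_sum {P : ℝ → ℝ} (hP : ∀ n : ℕ, Integrable fun x => x ^ n * P x)
    (h1 : ∫ x, P x = 1) (n : ℕ) :
    (moment P (n + 1) : ℂ) = ∑ i ∈ Finset.range (n + 1),
      (n.choose i : ℂ) * complexCumulant P (i + 1) * moment P (n - i) := by
  have hθ := contDiff_charFn hP
  have hL := contDiffAt_log_charFn hP h1
  have hev : deriv (charFn P)
      =ᶠ[𝓝 0] fun q => deriv (fun q : ℝ => Complex.log (charFn P q)) q * charFn P q := by
    have hs : ∀ᶠ q in 𝓝 (0 : ℝ), charFn P q ∈ Complex.slitPlane :=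
      hθ.continuous.continuousAt.eventually
        (Complex.isOpen_slitPlane.mem_nhds (charFn_zero_mem_slitPlane h1))
    filter_upwards [hs] with q hq
    have hd : HasDerivAt (charFn P) (deriv (charFn P) q) q :=
      ((hθ.differentiable (by simp)) q).hasDerivAt
    rw [(hd.clog_real hq).deriv, div_mul_cancel₀ _ (Complex.slitPlane_ne_zero hq)]
  have hL' : ContDiffAt ℝ n (deriv fun q : ℝ => Complex.log (charFn P q)) 0 :=
    hL.derivWithin (by exact_mod_cast le_top)
  have hsum := iteratedDeriv_charFn_zero hP (n + 1)
  rw [iteratedDeriv_succ', hev.iteratedDeriv_eq, iteratedDeriv_fun_mul hL'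
    (hθ.contDiffAt.of_le (by exact_mod_cast le_top))] at hsum
  have hI : ∀ k : ℕ, (-Complex.I) ^ k * Complex.I ^ k = 1 := fun k => by
    rw [← mul_pow]; simp
  calc (moment P (n + 1) : ℂ)
      = (-Complex.I) ^ (n + 1) * (Complex.I ^ (n + 1) * moment P (n + 1)) := by
        rw [← mul_assoc, hI, one_mul]
    _ = _ := by
        rw [← hsum, Finset.mul_sum]
        refine Finset.sum_congr rfl fun i hi => ?_
        have hin : n + 1 = (i + 1) + (n - i) := by
          have := Finset.mem_range.1 hi
          omega
        rw [complexCumulant, iteratedDeriv_succ', iteratedDeriv_charFn_zero hP]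
        nth_rewrite 1 [hin]
        rw [pow_add]
        linear_combination ((-Complex.I) ^ (i + 1) * (n.choose i : ℂ) *
          iteratedDeriv i (deriv fun q : ℝ => Complex.log (charFn P q)) 0 * moment P (n - i)) *
            hI (n - i)

theorem moment_zero (P : ℝ → ℝ) : moment P 0 = ∫ x, P x := by simp [moment]

theorem complexCumulant_succ {P : ℝ → ℝ} (hP : ∀ n : ℕ, Integrable fun x => x ^ n * P x)
    (h1 : ∫ x, P x = 1) (n : ℕ) :
    complexCumulant P (n + 1) = (moment P (n + 1) : ℂ) - ∑ i ∈ Finset.range n,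
      (n.choose i : ℂ) * complexCumulant P (i + 1) * moment P (n - i) := by
  rw [moment_succ_eq_sum hP h1 n, Finset.sum_range_succ]
  simp [moment_zero, h1]

theorem complexCumulant_eq_ofReal {P : ℝ → ℝ} (hP : ∀ n : ℕ, Integrable fun x => x ^ n * P x)
    (h1 : ∫ x, P x = 1) (n : ℕ) : complexCumulant P n = (cumulant P n : ℂ) := by
  suffices h : (complexCumulant P n).im = 0 from
    Complex.ext (by simp [cumulant]) (by simp [h])
  induction n using Nat.strong_induction_on with
  | _ n ih =>
    cases n with
    | zero => simp [complexCumulant, charFn_zero, h1]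
    | succ n =>
      rw [complexCumulant_succ hP h1, Complex.sub_im, Complex.ofReal_im, Complex.im_sum,
        Finset.sum_eq_zero, sub_zero]
      intro i hi
      have hi := ih (i + 1) (by have := Finset.mem_range.1 hi; omega)
      rw [Complex.im_mul_ofReal, ← Complex.ofReal_natCast, Complex.im_ofReal_mul, hi]
      simp

theorem cumulant_succ {P : ℝ → ℝ} (hP : ∀ n : ℕ, Integrable fun x => x ^ n * P x)
    (h1 : ∫ x, P x = 1) (n : ℕ) :
    cumulant P (n + 1) = moment P (n + 1) - ∑ i ∈ Finset.range n,
      (n.choose i : ℝ) * cumulant P (i + 1) * moment P (n - i) := by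
  have h := complexCumulant_succ hP h1 n
  simp only [complexCumulant_eq_ofReal hP h1] at h
  exact_mod_cast h

/-- No integrability or normalization is needed: the characteristic function of an even density is
even, hence so is its logarithm, and odd derivatives of an even function vanish at `0`. -/
theorem cumulant_eq_zero_of_even {P : ℝ → ℝ} (hP : ∀ x, P (-x) = P x) {j : ℕ} (hj : Odd j) :
    cumulant P j = 0 := by
  have hθ : ∀ q, charFn P (-q) = charFn P q := fun q => by
    rw [charFn, ← integral_neg_eq_self, charFn]
    simp [hP]
  have h := iteratedDeriv_comp_neg j (fun q : ℝ => Complex.log (charFn P q)) 0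
  simp only [hθ, neg_zero, hj.neg_one_pow, neg_smul, one_smul] at h
  rw [cumulant, complexCumulant, self_eq_neg.1 h]
  simp

/-! ### Asymptotics of moments and cumulants of the truncated density -/

theorem isLittleO_sub_mul_of_tendsto_div {ι : Type*} {F : Filter ι} {f h : ι → ℝ} {c : ℝ}
    (hh : ∀ i, h i ≠ 0) (hf : Tendsto (fun i => f i / h i) F (𝓝 c)) :
    (fun i => f i - h i * c) =o[F] h := by
  rw [isLittleO_iff_tendsto fun i hi => absurd hi (hh i)]
  have := hf.sub_const c
  rw [sub_self] at this
  refine this.congr fun i => ?_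
  have := hh i
  field_simp

section FirstOrder

variable {ι : Type*} {F : Filter ι} {α : ℝ} {γ l : ι → ℝ} {g : SchwartzMap ℝ ℝ}

/-- All limits are taken along `r = γ / l → 0⁺` and then composed with the given filter, as
dominated convergence requires a countably generated filter. -/
theorem tendsto_ratio (hα₀ : 0 < α) (hγ : ∀ i, 0 < γ i) (hl : ∀ i, 0 < l i)
    (hε : Tendsto (fun i => (γ i / l i) ^ α) F (𝓝 0)) :
    Tendsto (fun i => γ i / l i) F (𝓝[>] 0) := by
  have hr : ∀ i, 0 < γ i / l i := fun i => div_pos (hγ i) (hl i)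
  refine tendsto_nhdsWithin_iff.2 ⟨?_, .of_forall hr⟩
  have h := hε.rpow_const (p := α⁻¹) (Or.inr (by positivity))
  rw [Real.zero_rpow (by positivity)] at h
  refine h.congr fun i => ?_
  rw [← Real.rpow_mul (hr i).le, mul_inv_cancel₀ hα₀.ne', Real.rpow_one]

theorem tendsto_moment_div (hα₀ : 0 < α) (hα₂ : α < 2) (hg₀ : g 0 = 1) (hγ : ∀ i, 0 < γ i)
    (hl : ∀ i, 0 < l i) (hε : Tendsto (fun i => (γ i / l i) ^ α) F (𝓝 0)) {j : ℕ} (hj : 1 ≤ j) :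
    Tendsto (fun i => moment (truncDensity α (γ i) (l i) g) j / (l i ^ j * (γ i / l i) ^ α)) F
      (𝓝 (levyAmplitude α * truncMellin α g j)) := by
  have hr := tendsto_ratio hα₀ hγ hl hε
  have h := ((((tendsto_rawMoment_zero hα₀ hα₂ g hg₀).inv₀ one_ne_zero).mul
    (tendsto_rawMoment hα₀ hα₂ g hj))).comp hr
  rw [inv_one, one_mul] at h
  refine h.congr fun i => ?_
  have h1 := hl i
  have h2 := Real.rpow_pos_of_pos (div_pos (hγ i) (hl i)) α
  simp only [Function.comp]
  rw [moment_truncDensity (hγ i) (hl i)]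
  field_simp

theorem eventually_integral_truncDensity_eq_one (hα₀ : 0 < α) (hα₂ : α < 2) (hg₀ : g 0 = 1)
    (hγ : ∀ i, 0 < γ i) (hl : ∀ i, 0 < l i)
    (hε : Tendsto (fun i => (γ i / l i) ^ α) F (𝓝 0)) :
    ∀ᶠ i in F, ∫ x, truncDensity α (γ i) (l i) g x = 1 := by
  have hr := (tendsto_rawMoment_zero hα₀ hα₂ g hg₀).comp (tendsto_ratio hα₀ hγ hl hε)
  filter_upwards [hr.eventually_ne one_ne_zero] with i hi
  have hi : rawMoment α g 0 (γ i / l i) ≠ 0 := hi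
  rw [← moment_zero, moment_truncDensity (hγ i) (hl i), pow_zero, one_mul, inv_mul_cancel₀ hi]

/-- Cumulants have the first-order behaviour of moments, as the remaining terms of the
moment-cumulant recursion are products of two quantities of order `ε`. -/
theorem tendsto_cumulant_div (hα₀ : 0 < α) (hα₂ : α < 2) (hg₀ : g 0 = 1) (hγ : ∀ i, 0 < γ i)
    (hl : ∀ i, 0 < l i) (hε : Tendsto (fun i => (γ i / l i) ^ α) F (𝓝 0)) {j : ℕ} (hj : 1 ≤ j) :
    Tendsto (fun i => cumulant (truncDensity α (γ i) (l i) g) j / (l i ^ j * (γ i / l i) ^ α)) F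
      (𝓝 (levyAmplitude α * truncMellin α g j)) := by
  induction j using Nat.strong_induction_on with
  | _ j ih =>
    obtain ⟨n, rfl⟩ := Nat.exists_eq_add_of_le' hj
    have hsum : Tendsto (fun i => ∑ k ∈ Finset.range n, (n.choose k : ℝ) *
        (cumulant (truncDensity α (γ i) (l i) g) (k + 1) / (l i ^ (k + 1) * (γ i / l i) ^ α)) *
        (moment (truncDensity α (γ i) (l i) g) (n - k) / (l i ^ (n - k) * (γ i / l i) ^ α) *
          (γ i / l i) ^ α)) F (𝓝 (∑ k ∈ Finset.range n, (n.choose k : ℝ) *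
        (levyAmplitude α * truncMellin α g (k + 1)) *
        (levyAmplitude α * truncMellin α g (n - k) * 0))) := by
      refine tendsto_finsetSum _ fun k hk => ?_
      have hk := Finset.mem_range.1 hk
      exact ((ih (k + 1) (by omega) (by omega)).const_mul _).mul
        ((tendsto_moment_div hα₀ hα₂ hg₀ hγ hl hε (by omega)).mul hε)
    have h := (tendsto_moment_div hα₀ hα₂ hg₀ hγ hl hε hj).sub hsum
    -- the products of two first-order terms leave a spare factor `ε → 0`
    simp only [mul_zero, Finset.sum_const_zero, sub_zero] at h
    refine h.congr' ?_
    filter_upwards [eventually_integral_truncDensity_eq_one hα₀ hα₂ hg₀ hγ hl hε] with i hi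
    have h1 := hl i
    have h2 := Real.rpow_pos_of_pos (div_pos (hγ i) (hl i)) α
    rw [cumulant_succ (integrable_pow_mul_truncDensity hα₀ (hγ i) (hl i) g) hi, sub_div,
      Finset.sum_div]
    congr 1
    refine Finset.sum_congr rfl fun k hk => ?_
    have hk := Finset.mem_range.1 hk
    have hpow : l i ^ (n + 1) = l i ^ (k + 1) * l i ^ (n - k) := by
      rw [← pow_add]
      congr 1
      omega
    rw [hpow]
    field_simp

theorem tendsto_stdCumulant_div (hα₀ : 0 < α) (hα₂ : α < 2) (hg₀ : g 0 = 1) (hg : ∀ x, 0 ≤ g x)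
    (hγ : ∀ i, 0 < γ i) (hl : ∀ i, 0 < l i)
    (hε : Tendsto (fun i => (γ i / l i) ^ α) F (𝓝 0)) {j : ℕ} (hj : 1 ≤ j) :
    Tendsto (fun i => stdCumulant (truncDensity α (γ i) (l i) g) j /
        ((γ i / l i) ^ α) ^ (1 - (j : ℝ) / 2)) F
      (𝓝 (truncMellin α g j / (levyAmplitude α ^ ((j : ℝ) / 2 - 1) *
        truncMellin α g 2 ^ ((j : ℝ) / 2)))) := by
  have hA := levyAmplitude_pos hα₀ hα₂
  have hμ := truncMellin_pos hα₀ hα₂ g hg₀ hg (j := 2) (by norm_num) (by decide)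
  have sqrt_pow : ∀ {x : ℝ}, 0 ≤ x → Real.sqrt x ^ j = x ^ ((j : ℝ) / 2) := fun {x} hx => by
    rw [Real.sqrt_eq_rpow, ← Real.rpow_natCast, ← Real.rpow_mul hx]
    ring_nf
  have h := (tendsto_cumulant_div hα₀ hα₂ hg₀ hγ hl hε hj).div
    (((tendsto_cumulant_div hα₀ hα₂ hg₀ hγ hl hε (j := 2) (by norm_num)).sqrt).pow j)
    (by positivity)
  have hlim : levyAmplitude α * truncMellin α g j /
      Real.sqrt (levyAmplitude α * truncMellin α g 2) ^ j
      = truncMellin α g j / (levyAmplitude α ^ ((j : ℝ) / 2 - 1) *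
        truncMellin α g 2 ^ ((j : ℝ) / 2)) := by
    rw [sqrt_pow (by positivity), Real.mul_rpow hA.le hμ.le, Real.rpow_sub_one hA.ne']
    have := Real.rpow_pos_of_pos hA ((j : ℝ) / 2)
    field_simp
  rw [hlim] at h
  refine h.congr fun i => ?_
  have h1 := hl i
  have h2 := Real.rpow_pos_of_pos (div_pos (hγ i) (hl i)) α
  set ε := (γ i / l i) ^ α
  set κ := cumulant (truncDensity α (γ i) (l i) g)
  -- valid for either sign of `κ 2`: the factors taken out of the root are nonnegative
  have hsq : Real.sqrt (κ 2) = l i * Real.sqrt ε * Real.sqrt (κ 2 / (l i ^ 2 * ε)) := by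
    have he : κ 2 = l i ^ 2 * (ε * (κ 2 / (l i ^ 2 * ε))) := by field_simp
    nth_rewrite 1 [he]
    rw [Real.sqrt_mul (by positivity), Real.sqrt_mul h2.le, Real.sqrt_sq h1.le, mul_assoc]
  have hεj : ε ^ (1 - (j : ℝ) / 2) = ε / Real.sqrt ε ^ j := by
    rw [sqrt_pow h2.le, Real.rpow_sub h2, Real.rpow_one]
  have hs := Real.sqrt_pos.2 h2
  change κ j / (l i ^ j * ε) / Real.sqrt (κ 2 / (l i ^ 2 * ε)) ^ j
    = κ j / Real.sqrt (κ 2) ^ j / ε ^ (1 - (j : ℝ) / 2)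
  rw [hεj, hsq, mul_pow, mul_pow, div_div, div_div]
  congr 1
  field_simp

end FirstOrder

theorem truncMellin_eq_zero_of_even {g : ℝ → ℝ} (hg : ∀ x, g (-x) = g x) {j : ℕ} (hj : Odd j)
    (α : ℝ) : truncMellin α g j = 0 := by
  simp [truncMellin, parityPart, Nat.not_even_iff_odd.2 hj, hg]

theorem truncDensity_neg {g : ℝ → ℝ} (hg : ∀ x, g (-x) = g x) (α γ l x : ℝ) :
    truncDensity α γ l g (-x) = truncDensity α γ l g x := by
  rw [truncDensity, truncDensity, levyDensity_neg, neg_div, hg]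

end TruncatedLevy

end

theorem mainTheorem2 (α : ℝ) (hα₀ : 0 < α) (hα₂ : α < 2)
    (g : SchwartzMap ℝ ℝ) (hg₀ : g 0 = 1) (hg : ∀ x, 0 ≤ g x) :
    -- the coefficients `μ_j` are convergent Mellin transforms, positive for even `j`
    (∀ j : ℕ, 1 ≤ j →
      HasMellin (fun ξ : ℝ => (TruncatedLevy.parityPart g j ξ : ℂ)) ((j : ℂ) - (α : ℂ))
        (TruncatedLevy.truncMellin α g j : ℂ)) ∧
    (∀ j : ℕ, 1 ≤ j → Even j → 0 < TruncatedLevy.truncMellin α g j) ∧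
    -- asymptotics along any family of scales with `ε = (γ / l) ^ α → 0`
    (∀ {ι : Type*} (F : Filter ι) (γ l : ι → ℝ), (∀ i, 0 < γ i) → (∀ i, 0 < l i) →
      Tendsto (fun i => (γ i / l i) ^ α) F (𝓝 0) →
      -- the truncated density, its moments and its cumulants are well defined
      (∀ᶠ i in F,
        (∀ n : ℕ, MeasureTheory.Integrable
          (fun x : ℝ => x ^ n * TruncatedLevy.truncDensity α (γ i) (l i) g x)) ∧
        (∫ x : ℝ, TruncatedLevy.truncDensity α (γ i) (l i) g x) = 1 ∧
        ContDiffAt ℝ ∞ (fun q : ℝ => Complex.log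
          (TruncatedLevy.charFn (TruncatedLevy.truncDensity α (γ i) (l i) g) q)) 0 ∧
        (∀ n : ℕ,
          TruncatedLevy.complexCumulant (TruncatedLevy.truncDensity α (γ i) (l i) g) n =
            (TruncatedLevy.cumulant (TruncatedLevy.truncDensity α (γ i) (l i) g) n : ℂ))) ∧
      -- moments and cumulants to first order in `ε`
      (∀ j : ℕ, 1 ≤ j →
        (fun i => TruncatedLevy.moment (TruncatedLevy.truncDensity α (γ i) (l i) g) j -
            l i ^ ((j : ℝ) - α) * γ i ^ α * TruncatedLevy.levyAmplitude α *
              TruncatedLevy.truncMellin α g j)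
          =o[F] (fun i => l i ^ j * (γ i / l i) ^ α)) ∧
      (∀ j : ℕ, 1 ≤ j →
        (fun i => TruncatedLevy.cumulant (TruncatedLevy.truncDensity α (γ i) (l i) g) j -
            l i ^ ((j : ℝ) - α) * γ i ^ α * TruncatedLevy.levyAmplitude α *
              TruncatedLevy.truncMellin α g j)
          =o[F] (fun i => l i ^ j * (γ i / l i) ^ α)) ∧
      -- standardized cumulants
      (∀ j : ℕ, 3 ≤ j →
        (fun i => TruncatedLevy.stdCumulant (TruncatedLevy.truncDensity α (γ i) (l i) g) j -
            (l i / γ i) ^ (α * ((j : ℝ) - 2) / 2) *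
              (TruncatedLevy.truncMellin α g j /
                (TruncatedLevy.levyAmplitude α ^ ((j : ℝ) / 2 - 1) *
                  TruncatedLevy.truncMellin α g 2 ^ ((j : ℝ) / 2))))
          =o[F] (fun i => ((γ i / l i) ^ α) ^ (1 - (j : ℝ) / 2))) ∧
      (∀ j : ℕ, 3 ≤ j → TruncatedLevy.truncMellin α g j ≠ 0 →
        (fun i => TruncatedLevy.stdCumulant (TruncatedLevy.truncDensity α (γ i) (l i) g) j)
          =Θ[F] (fun i => ((γ i / l i) ^ α) ^ (1 - (j : ℝ) / 2)))) ∧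
    -- odd cumulants vanish under symmetric truncation
    ((∀ x, g (-x) = g x) → ∀ j : ℕ, Odd j →
      TruncatedLevy.truncMellin α g j = 0 ∧
      ∀ γ l : ℝ, 0 < γ → 0 < l →
        TruncatedLevy.cumulant (TruncatedLevy.truncDensity α γ l g) j = 0) := by
  refine ⟨fun j hj => TruncatedLevy.hasMellin_parityPart hα₀ hα₂ g hj,
    fun j hj he => TruncatedLevy.truncMellin_pos hα₀ hα₂ g hg₀ hg hj he, ?_,
    fun hsymm j hj => ⟨TruncatedLevy.truncMellin_eq_zero_of_even hsymm hj α, fun γ l _ _ =>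
      TruncatedLevy.cumulant_eq_zero_of_even (TruncatedLevy.truncDensity_neg hsymm α γ l) hj⟩⟩
  intro ι F γ l hγ hl hε
  have hr : ∀ i, 0 < γ i / l i := fun i => div_pos (hγ i) (hl i)
  have hpos : ∀ i, 0 < (γ i / l i) ^ α := fun i => Real.rpow_pos_of_pos (hr i) α
  have hne : ∀ (j : ℕ) (i : ι), l i ^ j * (γ i / l i) ^ α ≠ 0 := fun j i =>
    (mul_pos (pow_pos (hl i) j) (hpos i)).ne'
  have hne' : ∀ (j : ℕ) (i : ι), ((γ i / l i) ^ α) ^ (1 - (j : ℝ) / 2) ≠ 0 := fun j i =>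
    (Real.rpow_pos_of_pos (hpos i) _).ne'
  have hscale : ∀ (j : ℕ) (i : ι),
      l i ^ ((j : ℝ) - α) * γ i ^ α = l i ^ j * (γ i / l i) ^ α := fun j i => by
    rw [Real.rpow_sub (hl i), Real.rpow_natCast, Real.div_rpow (hγ i).le (hl i).le]
    ring
  refine ⟨?_, fun j hj => ?_, fun j hj => ?_, fun j hj => ?_, fun j hj hμ => ?_⟩
  · filter_upwards [TruncatedLevy.eventually_integral_truncDensity_eq_one hα₀ hα₂ hg₀ hγ hl hε]
      with i hi
    have hP := TruncatedLevy.integrable_pow_mul_truncDensity hα₀ (hγ i) (hl i) g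
    exact ⟨hP, hi, TruncatedLevy.contDiffAt_log_charFn hP hi,
      TruncatedLevy.complexCumulant_eq_ofReal hP hi⟩
  · simpa only [hscale, mul_assoc] using TruncatedLevy.isLittleO_sub_mul_of_tendsto_div (hne j)
      (TruncatedLevy.tendsto_moment_div hα₀ hα₂ hg₀ hγ hl hε hj)
  · simpa only [hscale, mul_assoc] using TruncatedLevy.isLittleO_sub_mul_of_tendsto_div (hne j)
      (TruncatedLevy.tendsto_cumulant_div hα₀ hα₂ hg₀ hγ hl hε hj)
  · have hstd : ∀ i, (l i / γ i) ^ (α * ((j : ℝ) - 2) / 2)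
        = ((γ i / l i) ^ α) ^ (1 - (j : ℝ) / 2) := fun i => by
      rw [← inv_div, Real.inv_rpow (hr i).le, ← Real.rpow_neg (hr i).le, ← Real.rpow_mul (hr i).le]
      ring_nf
    simpa only [hstd] using TruncatedLevy.isLittleO_sub_mul_of_tendsto_div (hne' j)
      (TruncatedLevy.tendsto_stdCumulant_div hα₀ hα₂ hg₀ hg hγ hl hε (by omega))
  · have hA := TruncatedLevy.levyAmplitude_pos hα₀ hα₂
    have hμ₂ := TruncatedLevy.truncMellin_pos hα₀ hα₂ g hg₀ hg (j := 2) (by norm_num) (by decide)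
    exact (Asymptotics.isTheta_of_div_tendsto_nhds_ne_zero
      (TruncatedLevy.tendsto_stdCumulant_div hα₀ hα₂ hg₀ hg hγ hl hε (by omega))
      (div_ne_zero hμ (by positivity))).symm
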